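/- Let $\mathbb F\in\{\mathbb R,\mathbb C,\mathbb H\}$ and let $G=\mathrm{SO}(k)\times\mathrm{SO}(2)$ (respectively $\mathrm S(\mathrm U(k)\times\mathrm U(2))=\{(A,B)\in \mathrm U(k)\times\mathrm U(2):\det A\det B=1\}$, $\mathrm{Sp}(k)\times\mathrm{Sp}(2)$) act on the real Euclidean space $\mathbb F^{k\times 2}$ of $k\times 2$ matrices over $\mathbb F$, with inner product $\langle C,D\rangle=\operatorname{Re}\operatorname{tr}(C^*D)$, by $(A,B)\cdot C=ACB^{-1}$ (the isotropy representation of the Grassmannian of $2$-planes in $\mathbb F^{k+2}$). For a smooth $n$-dimensional submanifold $M$ of a Euclidean space, with the induced Riemannian metric, let $I\!I$ be its second fundamental form, $R$ its curvature tensor (signed so that $R(v,w,v,w)$ is the sectional curvature of the plane spanned by orthonormal $v,w$) and $\operatorname{Ric}$ its Ricci tensor. We say that $M$ satisfies $\operatorname{ACS}<0$ if for every $p\in M$ and all $X,N\in T_pM$ with $\|X\|=\|N\|=1$ and $\langle X,N\rangle=0$, $$\operatorname{ACS}(X,N)=\sum_{i=1}^{n-1}\bigl(\|I\!I(e_i,X)\|^2+\|I\!I(e_i,N)\|^2\bigr)-\sum_{i=1}^{n-1}R(e_i,X,e_i,X)-\operatorname{Ric}(N,N)<0,$$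 where $e_1,\dots,e_{n-1}$ is any orthonormal basis of $N^\perp\subset T_pM$. Suppose $k\ge 6$ if $\mathbb F=\mathbb R$, $k\ge 4$ if $\mathbb F=\mathbb C$, $k\ge 3$ if $\mathbb F=\mathbb H$. Then the $G$-orbit of the matrix $\begin{pmatrix}1&0&0&\cdots&0\\0&1&0&\cdots&0\end{pmatrix}^{T}$ is the Stiefel variety $\{C\in\mathbb F^{k\times2}: C^*C=I_2\}$ of orthonormal $2$-frames in $\mathbb F^k$. It is contained in the sphere of radius $\sqrt2$ about the origin, it is a smooth embedded submanifold of $\mathbb F^{k\times 2}$ of dimension $2k-3$ (respectively $4k-4$, $8k-6$), that is, of codimension $2$ (respectively $3$, $5$) in the sphere, and with the induced metric it satisfies $\operatorname{ACS}<0$. -/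

import Mathlib

open scoped ContDiff Matrix Quaternion RealInnerProductSpace

noncomputable section

namespace ACS

/-! ## Riemannian metrics in a chart

Points and tangent vectors of a chart domain are elements of `EuclideanSpace ℝ (Fin n)`, used only
as the coordinate space `ℝⁿ`; the metric is the field of bilinear forms `g`. -/

section Chart

variable {n : ℕ}

/-- Levi-Civita connection of `g` in the chart: `christoffel g x u v` is the covariant derivative
`∇_u v` at `x` of the constant vector field `v` (for `u = ∂_i`, `v = ∂_j` its `k`-th coordinate is
the Christoffel symbol `Γ^k_{ij}`), determined by
`2 g(∇_u v, w) = (D_u g)(v, w) + (D_v g)(u, w) - (D_w g)(u, v)` for all `w`. -/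
def christoffel
    (g : EuclideanSpace ℝ (Fin n) →
      EuclideanSpace ℝ (Fin n) →L[ℝ] EuclideanSpace ℝ (Fin n) →L[ℝ] ℝ)
    (x u v : EuclideanSpace ℝ (Fin n)) : EuclideanSpace ℝ (Fin n) :=
  (g x).inverse ((1 / 2 : ℝ) •
    (fderiv ℝ g x u v + fderiv ℝ g x v u - ((fderiv ℝ g x).flip u).flip v))

/-- The curvature endomorphism `R(u, v) w = ∇_u ∇_v w - ∇_v ∇_u w` at `x`, where `u`, `v`, `w` are
extended to constant (hence commuting) vector fields. -/
def curvature
    (g : EuclideanSpace ℝ (Fin n) →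
      EuclideanSpace ℝ (Fin n) →L[ℝ] EuclideanSpace ℝ (Fin n) →L[ℝ] ℝ)
    (x u v w : EuclideanSpace ℝ (Fin n)) : EuclideanSpace ℝ (Fin n) :=
  fderiv ℝ (fun y => christoffel g y v w) x u - fderiv ℝ (fun y => christoffel g y u w) x v
    + christoffel g x u (christoffel g x v w) - christoffel g x v (christoffel g x u w)

/-- The curvature tensor, with the sign convention that the sectional curvature of the plane
spanned by a `g`-orthonormal pair `v, w` is `R(v, w, v, w)`. -/
def curvatureTensor
    (g : EuclideanSpace ℝ (Fin n) →
      EuclideanSpace ℝ (Fin n) →L[ℝ] EuclideanSpace ℝ (Fin n) →L[ℝ] ℝ)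
    (x u v w z : EuclideanSpace ℝ (Fin n)) : ℝ :=
  g x (curvature g x u v z) w

/-- The Ricci tensor `Ric(v, w)`: the trace of `z ↦ R(z, v) w`, computed in the coordinate basis. -/
def ricci
    (g : EuclideanSpace ℝ (Fin n) →
      EuclideanSpace ℝ (Fin n) →L[ℝ] EuclideanSpace ℝ (Fin n) →L[ℝ] ℝ)
    (x v w : EuclideanSpace ℝ (Fin n)) : ℝ :=
  ∑ i : Fin n, curvature g x (EuclideanSpace.single i 1) v w i

end Chart

/-! ## Immersions into a Euclidean space -/

section Immersion

variable {n : ℕ} {V : Type*} [NormedAddCommGroup V] [InnerProductSpace ℝ V]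

/-- The metric on the chart induced by `φ`: `(u, v) ↦ ⟪dφ_x u, dφ_x v⟫`. -/
def inducedMetric (φ : EuclideanSpace ℝ (Fin n) → V) (x : EuclideanSpace ℝ (Fin n)) :
    EuclideanSpace ℝ (Fin n) →L[ℝ] EuclideanSpace ℝ (Fin n) →L[ℝ] ℝ :=
  (innerSL ℝ).bilinearComp (fderiv ℝ φ x) (fderiv ℝ φ x)

/-- The second fundamental form of `φ` at `x`, applied to `dφ_x u` and `dφ_x v`: the component of
the second derivative `D²φ_x(u, v)` normal to the tangent space `dφ_x(ℝⁿ)`. -/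
def secondFundamentalForm (φ : EuclideanSpace ℝ (Fin n) → V)
    (x u v : EuclideanSpace ℝ (Fin n)) : V :=
  ((fderiv ℝ φ x).range)ᗮ.starProjection (fderiv ℝ (fderiv ℝ φ) x u v)

/-- The ACS quantity of `φ` at `x`, for tangent vectors `X`, `N` and the frame `e` of `N^⊥`. -/
def acs (φ : EuclideanSpace ℝ (Fin n) → V) (x : EuclideanSpace ℝ (Fin n))
    (e : Fin (n - 1) → EuclideanSpace ℝ (Fin n)) (X N : EuclideanSpace ℝ (Fin n)) : ℝ :=
  ∑ k, (‖secondFundamentalForm φ x (e k) X‖ ^ 2 + ‖secondFundamentalForm φ x (e k) N‖ ^ 2)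
    - ∑ k, curvatureTensor (inducedMetric φ) x (e k) X (e k) X
    - ricci (inducedMetric φ) x N N

/-- `φ`, restricted to the open set `U ⊆ ℝⁿ`, is a smooth local parametrization of `M ⊆ V`: an
immersion that is a homeomorphism from `U` onto a relatively open subset of `M`. -/
structure IsLocalParametrization (M : Set V) (U : Set (EuclideanSpace ℝ (Fin n)))
    (φ : EuclideanSpace ℝ (Fin n) → V) : Prop where
  isOpen : IsOpen U
  contDiffOn : ContDiffOn ℝ ∞ φ U
  injective_fderiv : ∀ x ∈ U, Function.Injective (fderiv ℝ φ x)
  isEmbedding : Topology.IsEmbedding (U.domRestrict φ)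
  image_eq : ∃ W : Set V, IsOpen W ∧ φ '' U = M ∩ W

/-- `M` is a smooth embedded `n`-dimensional submanifold of `V`. -/
def IsSubmanifold (n : ℕ) (M : Set V) : Prop :=
  ∀ p ∈ M, ∃ (U : Set (EuclideanSpace ℝ (Fin n))) (φ : EuclideanSpace ℝ (Fin n) → V),
    IsLocalParametrization M U φ ∧ p ∈ φ '' U

/-- The `n`-dimensional submanifold `M`, with the metric induced from `V`, satisfies `ACS < 0`:
at each point (seen through any local parametrization) and for all tangent vectors `X`, `N` there
with `‖X‖ = ‖N‖ = 1` and `X ⊥ N`, the ACS quantity is negative, where `e` is any orthonormal basis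
of the hyperplane `N^⊥` of the tangent space. -/
def NegativeACS (n : ℕ) (M : Set V) : Prop :=
  ∀ (U : Set (EuclideanSpace ℝ (Fin n))) (φ : EuclideanSpace ℝ (Fin n) → V),
    IsLocalParametrization M U φ →
    ∀ x ∈ U, ∀ (X N : EuclideanSpace ℝ (Fin n)) (e : Fin (n - 1) → EuclideanSpace ℝ (Fin n)),
      inducedMetric φ x X X = 1 → inducedMetric φ x N N = 1 → inducedMetric φ x X N = 0 →
      (∀ i j, inducedMetric φ x (e i) (e j) = if i = j then 1 else 0) →
      (∀ i, inducedMetric φ x (e i) N = 0) →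
      acs φ x e X N < 0

end Immersion

/-! ## Stiefel varieties -/

section Stiefel

variable (k : ℕ) {F : Type*}

/-- The matrix with rows `(1, 0)`, `(0, 1)`, `(0, 0)`, …, `(0, 0)`. -/
def baseFrame (F : Type*) [Ring F] : Matrix (Fin k) (Fin 2) F :=
  Matrix.of fun i j => if (i : ℕ) = (j : ℕ) then 1 else 0

/-- The Stiefel variety: `k × 2` matrices whose two columns are orthonormal. -/
def stiefel (F : Type*) [Ring F] [StarRing F] : Set (Matrix (Fin k) (Fin 2) F) :=
  {C | Cᴴ * C = 1}

/-- The product of the groups of unitary `k × k` and `2 × 2` matrices over `F`. -/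
abbrev UnitaryPairs (F : Type*) [Ring F] [StarRing F] : Type _ :=
  unitary (Matrix (Fin k) (Fin k) F) × unitary (Matrix (Fin 2) (Fin 2) F)

variable {k} in
/-- The orbit of `C` under `G`, acting by `(A, B) C = A C B⁻¹`. -/
def orbit [Ring F] [StarRing F] (G : Subgroup (UnitaryPairs k F))
    (C : Matrix (Fin k) (Fin 2) F) : Set (Matrix (Fin k) (Fin 2) F) :=
  {Y | ∃ g ∈ G, Y = (g.1 : Matrix (Fin k) (Fin k) F) * C *
    ((g.2⁻¹ : unitary (Matrix (Fin 2) (Fin 2) F)) : Matrix (Fin 2) (Fin 2) F)}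

/-- `SO(k) × SO(2)`. -/
def realGroup : Subgroup (UnitaryPairs k ℝ) where
  carrier := {g | (g.1 : Matrix (Fin k) (Fin k) ℝ).det = 1 ∧
    (g.2 : Matrix (Fin 2) (Fin 2) ℝ).det = 1}
  one_mem' := by simp
  mul_mem' := by
    rintro a b ⟨h1, h2⟩ ⟨h3, h4⟩
    simp [Matrix.det_mul, h1, h2, h3, h4]
  inv_mem' := by
    rintro a ⟨h1, h2⟩
    simp [← Unitary.star_eq_inv, Matrix.star_eq_conjTranspose, h1, h2]

/-- `S(U(k) × U(2))`. -/
def complexGroup : Subgroup (UnitaryPairs k ℂ) where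
  carrier := {g | (g.1 : Matrix (Fin k) (Fin k) ℂ).det *
    (g.2 : Matrix (Fin 2) (Fin 2) ℂ).det = 1}
  one_mem' := by simp
  mul_mem' := by
    rintro a b h1 h2
    simp only [Set.mem_ofPred_eq, Prod.fst_mul, Prod.snd_mul, Submonoid.coe_mul,
      Matrix.det_mul] at *
    rw [mul_mul_mul_comm, h1, h2, one_mul]
  inv_mem' := by
    rintro a h1
    simp only [Set.mem_ofPred_eq, Prod.fst_inv, Prod.snd_inv, ← Unitary.star_eq_inv,
      Unitary.coe_star, Matrix.star_eq_conjTranspose, Matrix.det_conjTranspose] at *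
    rw [← star_mul', h1, star_one]

/-- `Sp(k) × Sp(2)`: all pairs of quaternionic unitary matrices. -/
def quaternionicGroup : Subgroup (UnitaryPairs k ℍ[ℝ]) := ⊤

/-- `k × 2` matrices over `F ∈ {ℝ, ℂ, ℍ}` as a real Euclidean space: the inner product is the sum
over the entries of the real inner product of `F`, i.e. `Re tr (Cᴴ D)`. -/
abbrev MatrixSpace (F : Type*) : Type _ := PiLp 2 (fun _ : Fin k × Fin 2 => F)

variable {k} in
/-- A matrix as a vector of the Euclidean space of matrices. -/
def toMatrixSpace (C : Matrix (Fin k) (Fin 2) F) : MatrixSpace k F :=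
  WithLp.toLp 2 fun ij => C ij.1 ij.2

end Stiefel

end ACS

end

/-! By the Gauss equation, ACS is an expression in the second fundamental form II alone (`acs_eq`).
For a full tangent frame f with mean curvature vector H = ∑ II(f_j, f_j), it equals 2∑‖II(f_j, X)‖²
+ 2∑‖II(f_j, N)‖² - ⟪H, II(X, X)⟫ - ⟪H, II(N, N)⟫ plus terms that involve only X and N.

The Stiefel variety is an intersection of quadrics ⟪C, Q_a C⟫ = c_a, where Q_a is right
multiplication by the members of an orthonormal basis of the hermitian 2 × 2 matrices. At a point C
of it the vectors Q_a C are an orthonormal normal frame, and the component of II(X, Y) along Q_a C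
is -⟪X, Q_a Y⟫. Let d be the real dimension of the scalars. Then ∑‖Q_a X‖² = κ‖X‖² with κ = 1 + d/2,
which bounds the positive terms. Taking traces of the Q_a gives ⟪H, II(X, X)⟫ = dk - κ for unit X.
Altogether ACS ≤ 6κ + κ/4 - 2dk, which is negative for large k (`isQuadricSystem_hermitianOp`,
`negativeACS_quadricIntersection`). The submanifold charts come from the inverse function theorem
(`isSubmanifold_quadricIntersection`).

The orbit is all of the Stiefel variety because two unitary reflections carry the base frame to any
orthonormal 2-frame (`exists_unitary_mul_baseFrame`); for real and complex scalars a spare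
coordinate corrects the determinant. -/

noncomputable section

namespace ACS

/-! ### The Gauss equation and ACS in terms of the second fundamental form -/

section Gauss

variable {n : ℕ} {V : Type*} [NormedAddCommGroup V] [InnerProductSpace ℝ V]
  {φ : EuclideanSpace ℝ (Fin n) → V} {x : EuclideanSpace ℝ (Fin n)}

theorem inducedMetric_apply (φ : EuclideanSpace ℝ (Fin n) → V) (x u v : EuclideanSpace ℝ (Fin n)) :
    inducedMetric φ x u v = ⟪fderiv ℝ φ x u, fderiv ℝ φ x v⟫ := by
  simp [inducedMetric]

theorem contDiffAt_fderiv_of_top {W W' : Type*} [NormedAddCommGroup W] [NormedSpace ℝ W]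
    [NormedAddCommGroup W'] [NormedSpace ℝ W'] {f : W → W'} {y : W}
    (h : ContDiffAt ℝ ∞ f y) : ContDiffAt ℝ ∞ (fderiv ℝ f) y :=
  h.fderiv_right (by simp)

theorem _root_.ContDiffAt.differentiableAt_top {W W' : Type*} [NormedAddCommGroup W] [NormedSpace ℝ W]
    [NormedAddCommGroup W'] [NormedSpace ℝ W'] {f : W → W'} {y : W}
    (h : ContDiffAt ℝ ∞ f y) : DifferentiableAt ℝ f y :=
  h.differentiableAt (by simp)

theorem contDiffAt_flip {A B W : Type*} [NormedAddCommGroup A] [NormedSpace ℝ A]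
    [NormedAddCommGroup B] [NormedSpace ℝ B] [NormedAddCommGroup W] [NormedSpace ℝ W]
    {f : EuclideanSpace ℝ (Fin n) → A →L[ℝ] B →L[ℝ] W} (h : ContDiffAt ℝ ∞ f x) :
    ContDiffAt ℝ ∞ (fun y => (f y).flip) x := by
  have hL : ContDiff ℝ ∞ (fun g : A →L[ℝ] B →L[ℝ] W => g.flip) :=
    IsBoundedLinearMap.contDiff (IsLinearMap.with_bound
      ⟨fun _ _ => rfl, fun _ _ => rfl⟩ 1 fun g => by simp [ContinuousLinearMap.opNorm_flip])
  exact hL.contDiffAt.comp x h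

theorem contDiffAt_inducedMetric (h : ContDiffAt ℝ ∞ φ x) :
    ContDiffAt ℝ ∞ (inducedMetric φ) x := by
  have h1 := contDiffAt_fderiv_of_top h
  have h2 : ContDiffAt ℝ ∞ (fun y => (innerSL ℝ (E := V)).comp (fderiv ℝ φ y)) x :=
    contDiffAt_const.clm_comp h1
  exact contDiffAt_flip ((contDiffAt_flip h2).clm_comp h1)

theorem fderiv_inducedMetric (h : ContDiffAt ℝ ∞ φ x) (u v w : EuclideanSpace ℝ (Fin n)) :
    fderiv ℝ (inducedMetric φ) x u v w =
      ⟪fderiv ℝ (fderiv ℝ φ) x u v, fderiv ℝ φ x w⟫ +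
        ⟪fderiv ℝ φ x v, fderiv ℝ (fderiv ℝ φ) x u w⟫ := by
  have h1 := (contDiffAt_inducedMetric h).differentiableAt_top.hasFDerivAt
  have h2 := (contDiffAt_fderiv_of_top h).differentiableAt_top.hasFDerivAt
  have h3 := (h1.clm_apply (hasFDerivAt_const v x)).clm_apply (hasFDerivAt_const w x)
  have h4 := (h2.clm_apply (hasFDerivAt_const v x)).inner ℝ
    (h2.clm_apply (hasFDerivAt_const w x))
  have h5 := h3.unique (h4.congr_of_eventuallyEq
    (Filter.Eventually.of_forall fun y => inducedMetric_apply φ y v w))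
  have h6 := DFunLike.congr_fun h5 u
  simpa [add_comm] using h6

/-- `christoffel` is defined with `inverse`, which is zero on non-invertible maps; for an immersion
this case does not occur. -/
theorem inducedMetric_isInvertible (hinj : Function.Injective (fderiv ℝ φ x)) :
    (inducedMetric φ x).IsInvertible := by
  have hi : Function.Injective (inducedMetric φ x) := by
    rw [injective_iff_map_eq_zero]
    intro u hu
    have : inducedMetric φ x u u = 0 := by simp [hu]
    rw [inducedMetric_apply, inner_self_eq_zero] at this
    exact hinj (by simpa using this)
  let e : EuclideanSpace ℝ (Fin n) ≃ₗ[ℝ] (EuclideanSpace ℝ (Fin n) →L[ℝ] ℝ) :=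
    LinearEquiv.ofInjectiveOfFinrankEq (inducedMetric φ x).toLinearMap hi
      (InnerProductSpace.toDual ℝ (EuclideanSpace ℝ (Fin n))).toLinearEquiv.finrank_eq
  exact ⟨e.toContinuousLinearEquiv, by ext u v; rfl⟩

theorem isSymm_fderiv_fderiv {W : Type*} [NormedAddCommGroup W] [NormedSpace ℝ W]
    {f : EuclideanSpace ℝ (Fin n) → W} (h : ContDiffAt ℝ ∞ f x)
    (u v : EuclideanSpace ℝ (Fin n)) :
    fderiv ℝ (fderiv ℝ f) x u v = fderiv ℝ (fderiv ℝ f) x v u :=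
  (h.isSymmSndFDerivAt (by
    simpa using (WithTop.coe_le_coe.2 le_top : ((2 : ℕ∞) : WithTop ℕ∞) ≤ ∞))).eq u v

/-- The Levi-Civita connection is the tangential part of the second derivative. -/
theorem inner_fderiv_christoffel (h : ContDiffAt ℝ ∞ φ x)
    (hinj : Function.Injective (fderiv ℝ φ x)) (u v w : EuclideanSpace ℝ (Fin n)) :
    ⟪fderiv ℝ φ x (christoffel (inducedMetric φ) x u v), fderiv ℝ φ x w⟫ =
      ⟪fderiv ℝ (fderiv ℝ φ) x u v, fderiv ℝ φ x w⟫ := by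
  rw [← inducedMetric_apply, christoffel,
    (inducedMetric_isInvertible hinj).self_apply_inverse]
  simp only [_root_.smul_apply, _root_.sub_apply,
    _root_.add_apply, ContinuousLinearMap.flip_apply, fderiv_inducedMetric h,
    smul_eq_mul]
  -- Of the six terms in the Koszul formula, symmetry of D²φ cancels four and makes the other two
  -- equal.
  rw [isSymm_fderiv_fderiv h v u, isSymm_fderiv_fderiv h w u, isSymm_fderiv_fderiv h w v,
    real_inner_comm (fderiv ℝ (fderiv ℝ φ) x u w)]
  ring

theorem secondFundamentalForm_eq (h : ContDiffAt ℝ ∞ φ x)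
    (hinj : Function.Injective (fderiv ℝ φ x)) (u v : EuclideanSpace ℝ (Fin n)) :
    secondFundamentalForm φ x u v = fderiv ℝ (fderiv ℝ φ) x u v -
      fderiv ℝ φ x (christoffel (inducedMetric φ) x u v) := by
  refine (Submodule.eq_starProjection_of_mem_orthogonal' (v := fderiv ℝ (fderiv ℝ φ) x u v -
    fderiv ℝ φ x (christoffel (inducedMetric φ) x u v)) (z := fderiv ℝ φ x
    (christoffel (inducedMetric φ) x u v)) ?_ ?_ (sub_add_cancel _ _).symm)
  · rw [Submodule.mem_orthogonal']
    rintro _ ⟨w, rfl⟩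
    simp [inner_sub_left, inner_fderiv_christoffel h hinj]
  · exact Submodule.le_orthogonal_orthogonal _ ⟨_, rfl⟩

theorem inner_secondFundamentalForm_fderiv (φ : EuclideanSpace ℝ (Fin n) → V)
    (x u v w : EuclideanSpace ℝ (Fin n)) :
    ⟪secondFundamentalForm φ x u v, fderiv ℝ φ x w⟫ = 0 :=
  (Submodule.mem_orthogonal' _ _).1 (Submodule.starProjection_apply_mem _ _) _ ⟨w, rfl⟩

theorem secondFundamentalForm_comm (h : ContDiffAt ℝ ∞ φ x) (u v : EuclideanSpace ℝ (Fin n)) :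
    secondFundamentalForm φ x u v = secondFundamentalForm φ x v u := by
  simp only [secondFundamentalForm, isSymm_fderiv_fderiv h u v]

theorem contDiffAt_christoffel (h : ContDiffAt ℝ ∞ φ x)
    (hinj : Function.Injective (fderiv ℝ φ x)) (u v : EuclideanSpace ℝ (Fin n)) :
    ContDiffAt ℝ ∞ (fun y => christoffel (inducedMetric φ) y u v) x := by
  have hg := contDiffAt_inducedMetric h
  have hg' := contDiffAt_fderiv_of_top hg
  obtain ⟨e, he⟩ := inducedMetric_isInvertible hinj
  have hi : ContDiffAt ℝ ∞ (fun y => (inducedMetric φ y).inverse) x :=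
    ContDiffAt.comp x (f := inducedMetric φ) (g := ContinuousLinearMap.inverse)
      (by rw [← he]; exact contDiffAt_map_inverse e) hg
  unfold christoffel
  refine hi.clm_apply (ContDiffAt.const_smul _ (ContDiffAt.sub (ContDiffAt.add (f := fun y => fderiv ℝ (inducedMetric φ) y u v) ?_ ?_) ?_))
  · exact (hg'.clm_apply contDiffAt_const).clm_apply contDiffAt_const
  · exact (hg'.clm_apply contDiffAt_const).clm_apply contDiffAt_const
  · exact (contDiffAt_flip ((contDiffAt_flip hg').clm_apply contDiffAt_const)).clm_apply
      contDiffAt_const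

/-- Differentiate `inner_fderiv_christoffel` along u and collect the second-order terms: II(v, w) is
normal, so only the normal part of D²φ(u, z) is seen. The third derivative is symmetric in u and v,
hence drops out of the curvature. -/
theorem inner_fderiv_fderiv_christoffel {U : Set (EuclideanSpace ℝ (Fin n))} (hU : IsOpen U)
    (hφ : ContDiffOn ℝ ∞ φ U) (hinj : ∀ y ∈ U, Function.Injective (fderiv ℝ φ y)) (hx : x ∈ U)
    (u v w z : EuclideanSpace ℝ (Fin n)) :
    ⟪fderiv ℝ φ x (fderiv ℝ (fun y => christoffel (inducedMetric φ) y v w) x u),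
        fderiv ℝ φ x z⟫ +
      ⟪fderiv ℝ φ x (christoffel (inducedMetric φ) x u
        (christoffel (inducedMetric φ) x v w)), fderiv ℝ φ x z⟫ =
    ⟪fderiv ℝ (fderiv ℝ (fderiv ℝ φ)) x u v w, fderiv ℝ φ x z⟫ +
      ⟪secondFundamentalForm φ x v w, secondFundamentalForm φ x u z⟫ := by
  have hat : ∀ y ∈ U, ContDiffAt ℝ ∞ φ y := fun y hy => hφ.contDiffAt (hU.mem_nhds hy)
  have h := hat x hx
  have h1 := contDiffAt_fderiv_of_top h
  have hΓ := (contDiffAt_christoffel h (hinj x hx) v w).differentiableAt_top.hasFDerivAt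
  have d1 := h1.differentiableAt_top.hasFDerivAt
  have d2 := (contDiffAt_fderiv_of_top h1).differentiableAt_top.hasFDerivAt
  have dz := d1.clm_apply (hasFDerivAt_const z x)
  have e1 := (d1.clm_apply hΓ).inner ℝ dz
  have e2 := ((d2.clm_apply (hasFDerivAt_const v x)).clm_apply (hasFDerivAt_const w x)).inner ℝ dz
  have e3 := e2.unique (e1.congr_of_eventuallyEq (by
    filter_upwards [hU.mem_nhds hx] with y hy
    exact (inner_fderiv_christoffel (hat y hy) (hinj y hy) v w z).symm))
  have e4 := DFunLike.congr_fun e3 u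
  simp only [ContinuousLinearMap.comp_apply, ContinuousLinearMap.prod_apply, fderivInnerCLM_apply,
    _root_.add_apply, ContinuousLinearMap.flip_apply, _root_.zero_apply,
    inner_add_left, map_zero, zero_add] at e4
  have e5 := inner_fderiv_christoffel h (hinj x hx) u (christoffel (inducedMetric φ) x v w) z
  have e6 : ⟪secondFundamentalForm φ x v w, secondFundamentalForm φ x u z⟫ =
      ⟪secondFundamentalForm φ x v w, fderiv ℝ (fderiv ℝ φ) x u z⟫ := by
    rw [secondFundamentalForm_eq h (hinj x hx) u z, inner_sub_right,
      inner_secondFundamentalForm_fderiv, sub_zero]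
  rw [e6, secondFundamentalForm_eq h (hinj x hx) v w, inner_sub_left, e5]
  linarith

/-- The Gauss equation. -/
theorem curvature_inducedMetric {U : Set (EuclideanSpace ℝ (Fin n))} (hU : IsOpen U)
    (hφ : ContDiffOn ℝ ∞ φ U) (hinj : ∀ y ∈ U, Function.Injective (fderiv ℝ φ y)) (hx : x ∈ U)
    (u v w z : EuclideanSpace ℝ (Fin n)) :
    inducedMetric φ x (curvature (inducedMetric φ) x u v w) z =
      ⟪secondFundamentalForm φ x v w, secondFundamentalForm φ x u z⟫ -
        ⟪secondFundamentalForm φ x u w, secondFundamentalForm φ x v z⟫ := by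
  have h := hφ.contDiffAt (hU.mem_nhds hx)
  have h1 := inner_fderiv_fderiv_christoffel hU hφ hinj hx u v w z
  have h2 := inner_fderiv_fderiv_christoffel hU hφ hinj hx v u w z
  have h3 := isSymm_fderiv_fderiv (contDiffAt_fderiv_of_top h) u v
  rw [h3] at h1
  rw [inducedMetric_apply, curvature]
  simp only [map_sub, map_add, inner_sub_left, inner_add_left]
  linarith

theorem secondFundamentalForm_smul_left (φ : EuclideanSpace ℝ (Fin n) → V)
    (c : ℝ) (x u v : EuclideanSpace ℝ (Fin n)) :
    secondFundamentalForm φ x (c • u) v = c • secondFundamentalForm φ x u v := by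
  simp [secondFundamentalForm]

theorem secondFundamentalForm_sum_left {κ : Type*} (φ : EuclideanSpace ℝ (Fin n) → V)
    (s : Finset κ) (x : EuclideanSpace ℝ (Fin n)) (u : κ → EuclideanSpace ℝ (Fin n))
    (v : EuclideanSpace ℝ (Fin n)) :
    secondFundamentalForm φ x (∑ i ∈ s, u i) v =
      ∑ i ∈ s, secondFundamentalForm φ x (u i) v := by
  simp [secondFundamentalForm]

/-- The Ricci tensor in a frame that is orthonormal for the induced metric. -/
theorem ricci_inducedMetric {κ : Type*} [Fintype κ] [DecidableEq κ]
    {U : Set (EuclideanSpace ℝ (Fin n))} (hU : IsOpen U)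
    (hφ : ContDiffOn ℝ ∞ φ U) (hinj : ∀ y ∈ U, Function.Injective (fderiv ℝ φ y)) (hx : x ∈ U)
    (f : κ → EuclideanSpace ℝ (Fin n)) (hcard : Fintype.card κ = n)
    (hf : ∀ i j, inducedMetric φ x (f i) (f j) = if i = j then 1 else 0)
    (v : EuclideanSpace ℝ (Fin n)) :
    ricci (inducedMetric φ) x v v =
      ∑ j, (⟪secondFundamentalForm φ x v v, secondFundamentalForm φ x (f j) (f j)⟫ -
        ‖secondFundamentalForm φ x (f j) v‖ ^ 2) := by
  have h := hφ.contDiffAt (hU.mem_nhds hx)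
  have hort : ∀ y, ∑ j, inducedMetric φ x y (f j) • f j = y := by
    have hli : LinearIndependent ℝ f := by
      rw [Fintype.linearIndependent_iff]
      intro c hc i
      have := congrArg (inducedMetric φ x (f i)) hc
      simpa [hf] using this
    let b := basisOfLinearIndependentOfCardEqFinrank' f hli (by simpa using hcard)
    have hb : ⇑b = f := by simp [b]
    intro y
    conv_rhs => rw [← b.sum_repr y]
    refine Finset.sum_congr rfl fun j _ => ?_
    rw [hb]
    congr 1
    conv_lhs => rw [← b.sum_repr y]
    simp [hb, hf]
  unfold ricci
  -- Expand the curvature vector in the frame f and move the coordinate f_j^i into the slot of the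
  -- i-th basis vector; summing over i then reassembles f_j there.
  have key : ∀ i : Fin n,
      curvature (inducedMetric φ) x (EuclideanSpace.single i 1) v v i =
      ∑ j, (⟪secondFundamentalForm φ x v v,
          secondFundamentalForm φ x (f j i • EuclideanSpace.single i 1) (f j)⟫ -
        ⟪secondFundamentalForm φ x (f j i • EuclideanSpace.single i 1) v,
          secondFundamentalForm φ x v (f j)⟫) := by
    intro i
    conv_lhs => rw [← hort (curvature (inducedMetric φ) x (EuclideanSpace.single i 1) v v)]
    simp only [WithLp.ofLp_sum, WithLp.ofLp_smul, Finset.sum_apply, Pi.smul_apply, smul_eq_mul,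
      curvature_inducedMetric hU hφ hinj hx, secondFundamentalForm_smul_left, inner_smul_left,
      inner_smul_right]
    refine Finset.sum_congr rfl fun j _ => ?_
    simp
    ring
  have hsum : ∀ y : EuclideanSpace ℝ (Fin n),
      ∑ i, y i • EuclideanSpace.single i (1 : ℝ) = y := by
    intro y
    ext i
    simp [Finset.sum_apply, Pi.single_apply]
  simp only [key]
  rw [Finset.sum_comm]
  refine Finset.sum_congr rfl fun j _ => ?_
  rw [Finset.sum_sub_distrib, ← inner_sum, ← sum_inner, ← secondFundamentalForm_sum_left,
    ← secondFundamentalForm_sum_left, hsum, secondFundamentalForm_comm h v (f j),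
    real_inner_self_eq_norm_sq]

/-- The ACS quantity in terms of the second fundamental form alone. -/
theorem acs_eq {U : Set (EuclideanSpace ℝ (Fin n))} (hU : IsOpen U)
    (hφ : ContDiffOn ℝ ∞ φ U) (hinj : ∀ y ∈ U, Function.Injective (fderiv ℝ φ y)) (hx : x ∈ U)
    (hn : 0 < n) (X N : EuclideanSpace ℝ (Fin n))
    (f : Option (Fin (n - 1)) → EuclideanSpace ℝ (Fin n))
    (hf : ∀ i j, inducedMetric φ x (f i) (f j) = if i = j then 1 else 0) (hN : f none = N) :
    acs φ x (fun i => f (some i)) X N =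
      2 * ∑ j, ‖secondFundamentalForm φ x (f j) X‖ ^ 2 +
      2 * ∑ j, ‖secondFundamentalForm φ x (f j) N‖ ^ 2 -
      ∑ j, ⟪secondFundamentalForm φ x (f j) (f j), secondFundamentalForm φ x X X⟫ -
      ∑ j, ⟪secondFundamentalForm φ x (f j) (f j), secondFundamentalForm φ x N N⟫ -
      2 * ‖secondFundamentalForm φ x N X‖ ^ 2 - ‖secondFundamentalForm φ x N N‖ ^ 2 +
      ⟪secondFundamentalForm φ x N N, secondFundamentalForm φ x X X⟫ := by
  have h := hφ.contDiffAt (hU.mem_nhds hx)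
  rw [acs, ricci_inducedMetric hU hφ hinj hx f (by simp; omega) hf N]
  have hK : ∀ v, curvatureTensor (inducedMetric φ) x v X v X =
      ⟪secondFundamentalForm φ x v v, secondFundamentalForm φ x X X⟫ -
        ‖secondFundamentalForm φ x v X‖ ^ 2 := by
    intro v
    rw [curvatureTensor, curvature_inducedMetric hU hφ hinj hx,
      secondFundamentalForm_comm h X v, real_inner_self_eq_norm_sq, real_inner_comm]
  -- Splitting off the index `none`, that is N, turns sums over the frame of N^⊥ into sums over the
  -- full frame; this produces the last three terms.
  simp only [hK, Fintype.sum_option, Finset.sum_sub_distrib, Finset.sum_add_distrib, hN]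
  simp only [real_inner_comm (secondFundamentalForm φ x N N), real_inner_self_eq_norm_sq]
  ring

end Gauss

/-! ### Intersections of quadrics as submanifolds -/

section Quadrics

variable {V : Type*} [NormedAddCommGroup V] [InnerProductSpace ℝ V] {ι : Type*}

/-- The common level set `{C | ∀ a, ⟪C, Q a C⟫ = c a}` of a family of quadratic forms. -/
def quadricIntersection (Q : ι → V →L[ℝ] V) (c : ι → ℝ) : Set V :=
  {C | ∀ a, ⟪C, Q a C⟫ = c a}

/-- Self-adjoint operators `Q a` whose values at each point of the common level set of the forms
`⟪C, Q a C⟫` are an orthonormal frame of the normal space, such that `∑ a, Q a ^ 2 = κ` and such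
that the traces of the shape operators are controlled by `t` and `κ`. -/
structure IsQuadricSystem [Fintype ι] (Q : ι → V →L[ℝ] V) (c : ι → ℝ) (κ t : ℝ) : Prop where
  symm : ∀ a u v, ⟪Q a u, v⟫ = ⟪u, Q a v⟫
  orthonormal : ∀ C ∈ quadricIntersection Q c, Orthonormal ℝ fun a => Q a C
  sum_norm_sq : ∀ X, ∑ a, ‖Q a X‖ ^ 2 = κ * ‖X‖ ^ 2
  sum_trace : ∀ X, ∑ a, LinearMap.trace ℝ V (Q a).toLinearMap * ⟪X, Q a X⟫ = t * ‖X‖ ^ 2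
  sum_normal : ∀ C ∈ quadricIntersection Q c, ∀ X,
    ∑ a, (∑ b, ⟪Q b C, Q a (Q b C)⟫) * ⟪X, Q a X⟫ = κ * ‖X‖ ^ 2

variable {Q : ι → V →L[ℝ] V} {c : ι → ℝ} {κ t : ℝ}

theorem hasFDerivAt_quadric (hQ : ∀ a u v, ⟪Q a u, v⟫ = ⟪u, Q a v⟫) (a : ι) (C : V) :
    HasFDerivAt (fun y => ⟪y, Q a y⟫) ((2 : ℝ) • innerSL ℝ (Q a C)) C := by
  have h := (hasFDerivAt_id C).inner ℝ ((Q a).hasFDerivAt (x := C))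
  refine h.congr_fderiv ?_
  ext z
  simp [fderivInnerCLM_apply, two_mul, hQ a C z, real_inner_comm (Q a C) z]

theorem contDiff_quadric (a : ι) : ContDiff ℝ ∞ fun y => ⟪y, Q a y⟫ :=
  contDiff_id.inner ℝ (Q a).contDiff

/-- The gradients 2 Q_a p are independent, so the quadrics together with linear coordinates L on
their orthogonal complement form a local diffeomorphism Ψ at p. Charts are its inverse restricted to
the slice where the quadrics have the value c. -/
theorem isSubmanifold_quadricIntersection [Fintype ι] [FiniteDimensional ℝ V] {n : ℕ}
    (hQ : IsQuadricSystem Q c κ t) (hdim : n + Fintype.card ι = Module.finrank ℝ V) :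
    IsSubmanifold n (quadricIntersection Q c) := by
  intro p hp
  set K : Submodule ℝ V := Submodule.span ℝ (Set.range fun a => Q a p) with hK
  have hKdim : Module.finrank ℝ K = Fintype.card ι :=
    finrank_span_eq_card (hQ.orthonormal p hp).linearIndependent
  have hTdim : Module.finrank ℝ Kᗮ = Module.finrank ℝ (EuclideanSpace ℝ (Fin n)) := by
    have := K.finrank_add_finrank_orthogonal
    rw [finrank_euclideanSpace_fin]
    omega
  let e : Kᗮ ≃L[ℝ] EuclideanSpace ℝ (Fin n) :=
    (LinearEquiv.ofFinrankEq _ _ hTdim).toContinuousLinearEquiv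
  let L : V →L[ℝ] EuclideanSpace ℝ (Fin n) :=
    (e : Kᗮ →L[ℝ] EuclideanSpace ℝ (Fin n)).comp Kᗮ.orthogonalProjectionOnto
  have hL : ∀ z, L z = 0 → z ∈ K := by
    intro z hz
    have : Kᗮ.orthogonalProjectionOnto z = 0 := by
      apply e.injective
      simpa [L] using hz
    rw [Submodule.orthogonalProjectionOnto_eq_zero_iff] at this
    simpa using this
  let Ψ : V → EuclideanSpace ℝ (Fin n) × (ι → ℝ) := fun y => (L y, fun a => ⟪y, Q a y⟫)
  let D : V →L[ℝ] EuclideanSpace ℝ (Fin n) × (ι → ℝ) :=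
    L.prod (ContinuousLinearMap.pi fun a => (2 : ℝ) • innerSL ℝ (Q a p))
  have hΨ : ContDiff ℝ ∞ Ψ := L.contDiff.prodMk (contDiff_pi.2 fun a => contDiff_quadric a)
  have hD : HasFDerivAt Ψ D p :=
    (L.hasFDerivAt (x := p)).prodMk
      (hasFDerivAt_pi.2 fun a => hasFDerivAt_quadric hQ.symm a p)
  have hDinj : Function.Injective D := by
    rw [injective_iff_map_eq_zero]
    intro z hz
    have hz1 : L z = 0 := congrArg Prod.fst hz
    have hz2 : ∀ a, ⟪Q a p, z⟫ = 0 := fun a => by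
      have := congrFun (congrArg Prod.snd hz) a
      simpa [D] using this
    have hz3 : z ∈ Kᗮ := by
      rw [Submodule.mem_orthogonal]
      intro u hu
      induction hu using Submodule.span_induction with
      | mem u hu => obtain ⟨a, rfl⟩ := hu; exact hz2 a
      | zero => simp
      | add u v _ _ h1 h2 => simp [inner_add_left, h1, h2]
      | smul r u _ h => simp [inner_smul_left, h]
    have := (Submodule.mem_orthogonal _ _).1 hz3 z (hL z hz1)
    simpa using this
  let D' : V ≃L[ℝ] EuclideanSpace ℝ (Fin n) × (ι → ℝ) :=
    (LinearEquiv.ofInjectiveOfFinrankEq D.toLinearMap hDinj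
      (by simp [← hdim])).toContinuousLinearEquiv
  have hD' : HasFDerivAt Ψ (D' : V →L[ℝ] EuclideanSpace ℝ (Fin n) × (ι → ℝ)) p := hD
  let Φ₀ := hΨ.contDiffAt.toOpenPartialHomeomorph Ψ hD' (by simp)
  -- Restricting to the open set where dΨ is invertible makes the local inverse smooth at every
  -- point of its target, not only at Ψ p.
  let S : Set V := (fderiv ℝ Ψ) ⁻¹' Set.range
    ((↑) : (V ≃L[ℝ] EuclideanSpace ℝ (Fin n) × (ι → ℝ)) → V →L[ℝ] _)
  have hS : IsOpen S := ContinuousLinearEquiv.isOpen.preimage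
    (hΨ.continuous_fderiv (by simp))
  let Φ := Φ₀.restrOpen S hS
  have hΦ : ⇑Φ = Ψ := rfl
  have hpS : p ∈ Φ.source :=
    ⟨hΨ.contDiffAt.mem_toOpenPartialHomeomorph_source hD' (by simp), ⟨D', hD'.fderiv.symm⟩⟩
  let φ : EuclideanSpace ℝ (Fin n) → V := fun x => Φ.symm (x, c)
  let U : Set (EuclideanSpace ℝ (Fin n)) := (fun x => (x, c)) ⁻¹' Φ.target
  have hU : IsOpen U := Φ.open_target.preimage (by fun_prop)
  have hright : ∀ x ∈ U, Ψ (φ x) = (x, c) := fun x hx => Φ.right_inv hx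
  have hLφ : ∀ x ∈ U, L (φ x) = x := fun x hx => congrArg Prod.fst (hright x hx)
  have hsmooth : ∀ x ∈ U, ContDiffAt ℝ ∞ φ x := by
    intro x hx
    have hmem : Φ.symm (x, c) ∈ Φ.source := Φ.map_target hx
    obtain ⟨B, hB⟩ : Φ.symm (x, c) ∈ S := hmem.2
    have h1 : ContDiffAt ℝ ∞ Φ.symm (x, c) :=
      Φ.contDiffAt_symm (f₀' := B) hx
        (by rw [hB, hΦ]; exact (hΨ.differentiable (by simp) _).hasFDerivAt) hΨ.contDiffAt
    exact h1.comp x (contDiffAt_id.prodMk contDiffAt_const)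
  refine ⟨U, φ, ⟨hU, fun x hx => (hsmooth x hx).contDiffWithinAt, ?_, ?_, ?_⟩, ?_⟩
  · intro x hx
    have h1 : HasFDerivAt (fun y => L (φ y)) (L.comp (fderiv ℝ φ x)) x :=
      L.hasFDerivAt.comp x (hsmooth x hx).differentiableAt_top.hasFDerivAt
    have h2 := h1.unique ((hasFDerivAt_id x).congr_of_eventuallyEq (by
      filter_upwards [hU.mem_nhds hx] with y hy using hLφ y hy))
    exact Function.LeftInverse.injective (g := L) fun u => DFunLike.congr_fun h2 u
  -- L is a left inverse of φ on U. Its linear version gave injectivity of dφ; here it gives the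
  -- embedding.
  · refine Topology.IsEmbedding.of_comp (g := L) ?_ L.continuous ?_
    · exact continuousOn_iff_continuous_domRestrict.1
        fun x hx => (hsmooth x hx).continuousAt.continuousWithinAt
    · have : L ∘ U.domRestrict φ = Subtype.val := by
        ext1 x
        exact hLφ x x.2
      rw [this]
      exact Topology.IsEmbedding.subtypeVal
  · refine ⟨Φ.source, Φ.open_source, ?_⟩
    ext y
    constructor
    · rintro ⟨x, hx, rfl⟩
      exact ⟨fun a => congrFun (congrArg Prod.snd (hright x hx)) a, Φ.map_target hx⟩
    · rintro ⟨hy, hys⟩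
      have hy' : Φ y = (L y, c) := Prod.ext rfl (funext hy)
      refine ⟨L y, ?_, ?_⟩
      · show (L y, c) ∈ Φ.target
        rw [← hy']
        exact Φ.map_source hys
      · show Φ.symm (L y, c) = y
        rw [← hy']
        exact Φ.left_inv hys
  · have hy' : Φ p = (L p, c) := Prod.ext rfl (funext hp)
    refine ⟨L p, ?_, ?_⟩
    · show (L p, c) ∈ Φ.target
      rw [← hy']
      exact Φ.map_source hpS
    · show Φ.symm (L p, c) = p
      rw [← hy']
      exact Φ.left_inv hpS

/-! ### Second fundamental form of an intersection of quadrics -/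

section SecondFundamentalForm

variable {n : ℕ} {U : Set (EuclideanSpace ℝ (Fin n))} {φ : EuclideanSpace ℝ (Fin n) → V}
  {x : EuclideanSpace ℝ (Fin n)}

theorem inner_normal_fderiv (hQ : ∀ a u v, ⟪Q a u, v⟫ = ⟪u, Q a v⟫)
    (hφ : IsLocalParametrization (quadricIntersection Q c) U φ) (hx : x ∈ U) (a : ι)
    (u : EuclideanSpace ℝ (Fin n)) : ⟪Q a (φ x), fderiv ℝ φ x u⟫ = 0 := by
  obtain ⟨W, -, hW⟩ := hφ.image_eq
  have hM : ∀ y ∈ U, ⟪φ y, Q a (φ y)⟫ = c a := fun y hy =>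
    (hW.subset (Set.mem_image_of_mem φ hy)).1 a
  have h := hφ.contDiffOn.contDiffAt (hφ.isOpen.mem_nhds hx)
  have h1 : HasFDerivAt (fun y => ⟪φ y, Q a (φ y)⟫) _ x :=
    (hasFDerivAt_quadric hQ a (φ x)).comp x h.differentiableAt_top.hasFDerivAt
  have h2 := h1.unique ((hasFDerivAt_const (c a) x).congr_of_eventuallyEq (by
    filter_upwards [hφ.isOpen.mem_nhds hx] with y hy using hM y hy))
  simpa using DFunLike.congr_fun h2 u

/-- Differentiate the relation ⟪Q_a φ, dφ v⟫ = 0 along u; the tangential part of D²φ is orthogonal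
to Q_a φ. -/
theorem inner_normal_secondFundamentalForm (hQ : ∀ a u v, ⟪Q a u, v⟫ = ⟪u, Q a v⟫)
    (hφ : IsLocalParametrization (quadricIntersection Q c) U φ) (hx : x ∈ U) (a : ι)
    (u v : EuclideanSpace ℝ (Fin n)) :
    ⟪Q a (φ x), secondFundamentalForm φ x u v⟫ =
      -⟪fderiv ℝ φ x u, Q a (fderiv ℝ φ x v)⟫ := by
  have h := hφ.contDiffOn.contDiffAt (hφ.isOpen.mem_nhds hx)
  have h1 := ((Q a).hasFDerivAt.comp x h.differentiableAt_top.hasFDerivAt).inner ℝ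
    ((contDiffAt_fderiv_of_top h).differentiableAt_top.hasFDerivAt.clm_apply
      (hasFDerivAt_const v x))
  have h2 := h1.unique ((hasFDerivAt_const (0 : ℝ) x).congr_of_eventuallyEq (by
    filter_upwards [hφ.isOpen.mem_nhds hx] with y hy using inner_normal_fderiv hQ hφ hy a v))
  have h3 := DFunLike.congr_fun h2 u
  simp only [ContinuousLinearMap.comp_apply, ContinuousLinearMap.prod_apply, fderivInnerCLM_apply,
    _root_.add_apply, ContinuousLinearMap.flip_apply, _root_.zero_apply, map_zero,
    zero_add, Function.comp_apply] at h3
  rw [secondFundamentalForm_eq h (hφ.injective_fderiv x hx), inner_sub_right,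
    inner_normal_fderiv hQ hφ hx, ← hQ]
  linarith

variable {μ : Type*} {f : μ → EuclideanSpace ℝ (Fin n)}

theorem orthonormal_fderiv_frame [DecidableEq μ]
    (hf : ∀ i j, inducedMetric φ x (f i) (f j) = if i = j then 1 else 0) :
    Orthonormal ℝ fun j => fderiv ℝ φ x (f j) := by
  rw [orthonormal_iff_ite]
  intro i j
  rw [← inducedMetric_apply, hf]

variable [Fintype ι] [Fintype μ]

/-- A tangent frame together with the normal frame is an orthonormal basis. -/
theorem exists_adapted_orthonormalBasis [DecidableEq μ] [FiniteDimensional ℝ V] (hQ : IsQuadricSystem Q c κ t)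
    (hφ : IsLocalParametrization (quadricIntersection Q c) U φ) (hx : x ∈ U)
    (hC : φ x ∈ quadricIntersection Q c)
    (hcard : Fintype.card μ + Fintype.card ι = Module.finrank ℝ V)
    (hf : ∀ i j, inducedMetric φ x (f i) (f j) = if i = j then 1 else 0) :
    ∃ b : OrthonormalBasis (μ ⊕ ι) ℝ V, (∀ j, b (Sum.inl j) = fderiv ℝ φ x (f j)) ∧
      ∀ a, b (Sum.inr a) = Q a (φ x) := by
  classical
  have ho : Orthonormal ℝ (Sum.elim (fun j => fderiv ℝ φ x (f j)) fun a => Q a (φ x)) := by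
    rw [orthonormal_iff_ite]
    have h1 := orthonormal_iff_ite.1 (orthonormal_fderiv_frame hf)
    have h2 := orthonormal_iff_ite.1 (hQ.orthonormal _ hC)
    rintro (i | a) (j | b)
    · simpa using h1 i j
    · simpa [real_inner_comm] using inner_normal_fderiv hQ.symm hφ hx b (f i)
    · simpa using inner_normal_fderiv hQ.symm hφ hx a (f j)
    · simpa using h2 a b
  have hcard' : Fintype.card (μ ⊕ ι) = Module.finrank ℝ V := by simpa using hcard
  let b₀ := basisOfLinearIndependentOfCardEqFinrank' _ ho.linearIndependent hcard'
  have hb : ⇑b₀ = Sum.elim (fun j => fderiv ℝ φ x (f j)) fun a => Q a (φ x) := by simp [b₀]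
  refine ⟨b₀.toOrthonormalBasis (by rwa [hb]), fun j => ?_, fun a => ?_⟩ <;> simp [hb]

/-- Only the normal members of the adapted basis see II, and the two minus signs cancel. -/
theorem inner_secondFundamentalForm_secondFundamentalForm [FiniteDimensional ℝ V]
    (hQ : IsQuadricSystem Q c κ t)
    (hφ : IsLocalParametrization (quadricIntersection Q c) U φ) (hx : x ∈ U)
    {b : OrthonormalBasis (μ ⊕ ι) ℝ V} (hb : ∀ j, b (Sum.inl j) = fderiv ℝ φ x (f j))
    (hb' : ∀ a, b (Sum.inr a) = Q a (φ x)) (u v w z : EuclideanSpace ℝ (Fin n)) :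
    ⟪secondFundamentalForm φ x u v, secondFundamentalForm φ x w z⟫ =
      ∑ a, ⟪fderiv ℝ φ x u, Q a (fderiv ℝ φ x v)⟫ * ⟪fderiv ℝ φ x w, Q a (fderiv ℝ φ x z)⟫ := by
  rw [← b.sum_inner_mul_inner, Fintype.sum_sum_type]
  simp only [hb, hb', inner_secondFundamentalForm_fderiv, zero_mul, Finset.sum_const_zero,
    zero_add, real_inner_comm (Q _ (φ x)), inner_normal_secondFundamentalForm hQ.symm hφ hx]
  simp

/-- `∑ j, ‖II(e j, X)‖² ≤ κ ‖X‖²`, by Bessel's inequality. -/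
theorem sum_sq_secondFundamentalForm_le [DecidableEq μ] [FiniteDimensional ℝ V] (hQ : IsQuadricSystem Q c κ t)
    (hφ : IsLocalParametrization (quadricIntersection Q c) U φ) (hx : x ∈ U)
    (hf : ∀ i j, inducedMetric φ x (f i) (f j) = if i = j then 1 else 0)
    {b : OrthonormalBasis (μ ⊕ ι) ℝ V} (hb : ∀ j, b (Sum.inl j) = fderiv ℝ φ x (f j))
    (hb' : ∀ a, b (Sum.inr a) = Q a (φ x)) (X : EuclideanSpace ℝ (Fin n)) :
    ∑ j, ‖secondFundamentalForm φ x (f j) X‖ ^ 2 ≤ κ * ‖fderiv ℝ φ x X‖ ^ 2 := by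
  simp only [← real_inner_self_eq_norm_sq (secondFundamentalForm _ _ _ _),
    inner_secondFundamentalForm_secondFundamentalForm hQ hφ hx hb hb']
  rw [Finset.sum_comm, ← hQ.sum_norm_sq]
  refine Finset.sum_le_sum fun a _ => ?_
  have h := (orthonormal_fderiv_frame hf).sum_inner_products_le (Q a (fderiv ℝ φ x X))
    (s := Finset.univ)
  refine le_trans (le_of_eq (Finset.sum_congr rfl fun j _ => ?_)) h
  rw [Real.norm_eq_abs, sq_abs, sq]

theorem norm_sq_secondFundamentalForm_self_le [FiniteDimensional ℝ V]
    (hQ : IsQuadricSystem Q c κ t)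
    (hφ : IsLocalParametrization (quadricIntersection Q c) U φ) (hx : x ∈ U)
    {b : OrthonormalBasis (μ ⊕ ι) ℝ V} (hb : ∀ j, b (Sum.inl j) = fderiv ℝ φ x (f j))
    (hb' : ∀ a, b (Sum.inr a) = Q a (φ x)) (X : EuclideanSpace ℝ (Fin n))
    (hX : ‖fderiv ℝ φ x X‖ = 1) : ‖secondFundamentalForm φ x X X‖ ^ 2 ≤ κ := by
  rw [← real_inner_self_eq_norm_sq,
    inner_secondFundamentalForm_secondFundamentalForm hQ hφ hx hb hb',
    show κ = κ * ‖fderiv ℝ φ x X‖ ^ 2 by simp [hX], ← hQ.sum_norm_sq]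
  refine Finset.sum_le_sum fun a _ => ?_
  have h := abs_real_inner_le_norm (fderiv ℝ φ x X) (Q a (fderiv ℝ φ x X))
  rw [hX, one_mul] at h
  rw [← sq, ← sq_abs]
  gcongr

/-- The mean curvature vector paired with `II(X, X)`. -/
theorem sum_inner_secondFundamentalForm_diag [FiniteDimensional ℝ V]
    (hQ : IsQuadricSystem Q c κ t)
    (hφ : IsLocalParametrization (quadricIntersection Q c) U φ) (hx : x ∈ U)
    (hC : φ x ∈ quadricIntersection Q c)
    {b : OrthonormalBasis (μ ⊕ ι) ℝ V} (hb : ∀ j, b (Sum.inl j) = fderiv ℝ φ x (f j))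
    (hb' : ∀ a, b (Sum.inr a) = Q a (φ x)) (X : EuclideanSpace ℝ (Fin n)) :
    ∑ j, ⟪secondFundamentalForm φ x (f j) (f j), secondFundamentalForm φ x X X⟫ =
      (t - κ) * ‖fderiv ℝ φ x X‖ ^ 2 := by
  simp only [inner_secondFundamentalForm_secondFundamentalForm hQ hφ hx hb hb']
  rw [Finset.sum_comm, sub_mul, ← hQ.sum_trace, ← hQ.sum_normal _ hC, ← Finset.sum_sub_distrib]
  refine Finset.sum_congr rfl fun a _ => ?_
  -- The trace of Q_a in the adapted basis splits into a tangential and a normal sum, so the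
  -- tangential sum is the trace minus the term handled by `sum_normal`.
  rw [← Finset.sum_mul, ← sub_mul, LinearMap.trace_eq_sum_inner _ b, Fintype.sum_sum_type]
  simp [hb, hb']

end SecondFundamentalForm

/-! ### The ACS estimate -/

/-- The four parts of `acs_eq` contribute as follows: the squared sums at most 4κ, the mean
curvature terms -2(t - κ), the mixed term -2‖II(N, X)‖² at most 0, and the remaining terms in II(N,
N) at most κ/4. -/
theorem negativeACS_quadricIntersection [Fintype ι] [FiniteDimensional ℝ V] {n : ℕ}
    (hQ : IsQuadricSystem Q c κ t) (hn : 0 < n)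
    (hdim : n + Fintype.card ι = Module.finrank ℝ V) (hneg : 6 * κ + κ / 4 < 2 * t) :
    NegativeACS n (quadricIntersection Q c) := by
  intro U φ hφ x hx X N e hX hN hXN he heN
  let f : Option (Fin (n - 1)) → EuclideanSpace ℝ (Fin n) := fun o => o.elim N e
  have hf : ∀ i j, inducedMetric φ x (f i) (f j) = if i = j then 1 else 0 := by
    have hsymm : ∀ u v, inducedMetric φ x u v = inducedMetric φ x v u := fun u v => by
      rw [inducedMetric_apply, inducedMetric_apply, real_inner_comm]
    rintro (_ | i) (_ | j)
    · simpa [f] using hN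
    · simpa [f, hsymm N] using heN j
    · simpa [f] using heN i
    · simpa [f] using he i j
  have hC : φ x ∈ quadricIntersection Q c := by
    obtain ⟨W, -, hW⟩ := hφ.image_eq
    exact (hW.subset (Set.mem_image_of_mem φ hx)).1
  obtain ⟨b, hb, hb'⟩ := exists_adapted_orthonormalBasis hQ hφ hx hC
    (by rw [← hdim]; simp; omega) hf
  have hX1 : ‖fderiv ℝ φ x X‖ = 1 := by
    rw [inducedMetric_apply, real_inner_self_eq_norm_sq] at hX
    exact (pow_eq_one_iff_of_nonneg (norm_nonneg _) two_ne_zero).1 hX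
  have hN1 : ‖fderiv ℝ φ x N‖ = 1 := by
    rw [inducedMetric_apply, real_inner_self_eq_norm_sq] at hN
    exact (pow_eq_one_iff_of_nonneg (norm_nonneg _) two_ne_zero).1 hN
  have hacs := acs_eq hφ.isOpen hφ.contDiffOn hφ.injective_fderiv hx hn X N f hf rfl
  rw [sum_inner_secondFundamentalForm_diag hQ hφ hx hC hb hb' X,
    sum_inner_secondFundamentalForm_diag hQ hφ hx hC hb hb' N, hX1, hN1] at hacs
  have h1 := sum_sq_secondFundamentalForm_le hQ hφ hx hf hb hb' X
  have h2 := sum_sq_secondFundamentalForm_le hQ hφ hx hf hb hb' N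
  rw [hX1] at h1
  rw [hN1] at h2
  have h3 := norm_sq_secondFundamentalForm_self_le hQ hφ hx hb hb' X hX1
  have h4 := real_inner_le_norm (secondFundamentalForm φ x N N) (secondFundamentalForm φ x X X)
  -- With y = ‖II(N, N)‖ and x = ‖II(X, X)‖ this is yx - y² ≤ x²/4, and x² ≤ κ by `h3`.
  have h5 := sq_nonneg
    (‖secondFundamentalForm φ x N N‖ - ‖secondFundamentalForm φ x X X‖ / 2)
  have h6 := sq_nonneg ‖secondFundamentalForm φ x N X‖
  have h7 : acs φ x e X N = acs φ x (fun i => f (some i)) X N := rfl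
  rw [h7, hacs]
  nlinarith

end Quadrics

/-! ### The Stiefel variety as an intersection of hermitian quadrics -/

section StiefelQuadrics

variable {F : Type*} [NormedDivisionRing F] [InnerProductSpace ℝ F] {k : ℕ}

theorem MatrixSpace.inner_eq (C D : MatrixSpace k F) :
    ⟪C, D⟫ = ∑ i, (⟪C (i, 0), D (i, 0)⟫ + ⟪C (i, 1), D (i, 1)⟫) := by
  simp [PiLp.inner_apply, Fintype.sum_prod_type, Fin.sum_univ_two]

theorem MatrixSpace.norm_sq_eq (C : MatrixSpace k F) :
    ‖C‖ ^ 2 = ∑ i, (‖C (i, 0)‖ ^ 2 + ‖C (i, 1)‖ ^ 2) := by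
  rw [← real_inner_self_eq_norm_sq, MatrixSpace.inner_eq]
  simp only [real_inner_self_eq_norm_sq]

theorem trace_eq_sum_inner_apply {μ : Type*} [Fintype μ] (u : OrthonormalBasis μ ℝ F)
    (T : MatrixSpace k F →ₗ[ℝ] MatrixSpace k F) :
    LinearMap.trace ℝ (MatrixSpace k F) T =
      ∑ ij : Fin k × Fin 2, ∑ m, ⟪u m, T (WithLp.toLp 2 (Pi.single ij (u m))) ij⟫ := by
  classical
  rw [LinearMap.trace_eq_sum_inner T (Pi.orthonormalBasis fun _ : Fin k × Fin 2 => u),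
    Fintype.sum_sigma]
  refine Finset.sum_congr rfl fun ij _ => Finset.sum_congr rfl fun m _ => ?_
  rw [Pi.orthonormalBasis_apply, PiLp.inner_apply, Finset.sum_eq_single ij]
  · simp
  · intro b _ hb
    simp [hb]
  · simp

section Column

variable [FiniteDimensional ℝ F]

variable (F k) in
/-- Right multiplication by the diagonal matrix unit at `l`. -/
def columnOp (l : Fin 2) : MatrixSpace k F →L[ℝ] MatrixSpace k F :=
  LinearMap.toContinuousLinearMap
    { toFun C := WithLp.toLp 2 fun ij => if ij.2 = l then C ij else 0
      map_add' C D := by ext ij; simp; split_ifs <;> simp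
      map_smul' r C := by ext ij; simp }

@[simp] theorem columnOp_apply (l : Fin 2) (C : MatrixSpace k F) (i : Fin k) (j : Fin 2) :
    columnOp F k l C (i, j) = if j = l then C (i, j) else 0 := rfl

theorem inner_columnOp_zero (C : MatrixSpace k F) :
    ⟪C, columnOp F k 0 C⟫ = ∑ i, ‖C (i, 0)‖ ^ 2 := by
  simp [MatrixSpace.inner_eq]

theorem inner_columnOp_one (C : MatrixSpace k F) :
    ⟪C, columnOp F k 1 C⟫ = ∑ i, ‖C (i, 1)‖ ^ 2 := by
  simp [MatrixSpace.inner_eq]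

theorem trace_columnOp {μ : Type*} [Fintype μ] (u : OrthonormalBasis μ ℝ F) (l : Fin 2) :
    LinearMap.trace ℝ (MatrixSpace k F) (columnOp F k l).toLinearMap =
      Fintype.card μ * k := by
  rw [trace_eq_sum_inner_apply u, Fintype.sum_prod_type]
  fin_cases l <;> simp [Fin.sum_univ_two, mul_comm]

end Column

variable [StarRing F]

/-- The columns of `C` are orthonormal over `F`. -/
def HasOrthonormalColumns (C : MatrixSpace k F) : Prop :=
  ∑ i, ‖C (i, 0)‖ ^ 2 = 1 ∧ ∑ i, ‖C (i, 1)‖ ^ 2 = 1 ∧ ∑ i, star (C (i, 0)) * C (i, 1) = 0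

theorem norm_sq_of_hasOrthonormalColumns {C : MatrixSpace k F} (hC : HasOrthonormalColumns C) :
    ‖C‖ ^ 2 = 2 := by
  rw [MatrixSpace.norm_sq_eq, Finset.sum_add_distrib, hC.1, hC.2.1]
  norm_num

/-- A division ring with involution whose norm is Euclidean and satisfies `a⋆ a = ‖a‖²`, with
multiplication by `a⋆` adjoint to multiplication by `a`: the reals, complexes or quaternions. -/
class IsEuclideanStarRing (F : Type*) [NormedDivisionRing F] [InnerProductSpace ℝ F]
    [StarRing F] : Prop where
  smul_mul (r : ℝ) (a b : F) : r • a * b = r • (a * b)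
  mul_smul (r : ℝ) (a b : F) : a * r • b = r • (a * b)
  inner_mul_left_eq (a b c : F) : ⟪a * b, c⟫ = ⟪b, star a * c⟫
  inner_mul_right_eq (a b c : F) : ⟪a * b, c⟫ = ⟪a, c * star b⟫
  star_mul_self_eq (a : F) : star a * a = ‖a‖ ^ 2 • (1 : F)

open IsEuclideanStarRing

instance : IsEuclideanStarRing ℝ where
  smul_mul r a b := by simp [mul_assoc]
  mul_smul r a b := by simp [mul_left_comm]
  inner_mul_left_eq a b c := by simp; ring
  inner_mul_right_eq a b c := by simp; ring
  star_mul_self_eq a := by simp [sq]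

instance : IsEuclideanStarRing ℂ where
  smul_mul r a b := by simp [mul_assoc]
  mul_smul r a b := by simp [mul_left_comm]
  inner_mul_left_eq a b c := by simp [Complex.inner]; ring
  inner_mul_right_eq a b c := by simp [Complex.inner]; ring
  star_mul_self_eq a := by
    have := Complex.conj_mul' a
    simpa using this

instance : IsEuclideanStarRing ℍ[ℝ] where
  smul_mul r a b := by simp
  mul_smul r a b := by simp
  inner_mul_left_eq a b c := by simp [Quaternion.inner_def]; ring
  inner_mul_right_eq a b c := by simp [Quaternion.inner_def]; ring
  star_mul_self_eq a := by
    rw [Quaternion.star_mul_self, Quaternion.normSq_eq_norm_mul_self, ← sq, Algebra.smul_def,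
      mul_one]
    rfl

variable [IsEuclideanStarRing F]

theorem inner_mul_mul_left (a b c : F) : ⟪a * b, a * c⟫ = ‖a‖ ^ 2 * ⟪b, c⟫ := by
  rw [inner_mul_left_eq, ← mul_assoc, star_mul_self_eq, smul_mul, one_mul, inner_smul_right]

theorem inner_star_star (a b : F) : ⟪star a, star b⟫ = ⟪a, b⟫ := by
  rw [← mul_one (star a), inner_mul_left_eq, star_star, ← inner_mul_right_eq, one_mul,
    real_inner_comm]

theorem norm_star_eq (a : F) : ‖star a‖ = ‖a‖ := by
  rw [@norm_eq_sqrt_real_inner F, @norm_eq_sqrt_real_inner F, inner_star_star]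

theorem toMatrixSpace_image_stiefel :
    toMatrixSpace '' stiefel k F = {C : MatrixSpace k F | HasOrthonormalColumns C} := by
  have hinj : ∀ r : ℝ, r • (1 : F) = 1 ↔ r = 1 := fun r =>
    ⟨fun h => smul_left_injective ℝ (one_ne_zero (α := F)) (by simpa using h), fun h => by simp [h]⟩
  have key : ∀ A : Matrix (Fin k) (Fin 2) F,
      A ∈ stiefel k F ↔ HasOrthonormalColumns (toMatrixSpace A) := by
    intro A
    simp only [stiefel, Set.mem_ofPred_eq, ← Matrix.ext_iff, Fin.forall_fin_two, Matrix.mul_apply,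
      Matrix.conjTranspose_apply, star_mul_self_eq, ← Finset.sum_smul, HasOrthonormalColumns,
      toMatrixSpace, Matrix.one_apply]
    simp only [if_true, hinj, one_ne_zero, zero_ne_one, if_false]
    constructor
    · rintro ⟨⟨h1, h2⟩, h3, h4⟩
      exact ⟨h1, h4, h2⟩
    · rintro ⟨h1, h2, h3⟩
      refine ⟨⟨h1, h3⟩, ?_, h2⟩
      -- The two off-diagonal entries of C^* C are conjugate, so one orthogonality relation
      -- suffices.
      have := congrArg star h3
      simpa [star_sum] using this
  ext C
  constructor
  · rintro ⟨A, hA, rfl⟩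
    exact (key A).1 hA
  · intro hC
    exact ⟨Matrix.of fun i j => C (i, j), (key _).2 hC, rfl⟩

theorem sum_inner_mul_mul (C : MatrixSpace k F) (j : Fin 2) (a b : F) :
    ∑ i, ⟪C (i, j) * a, C (i, j) * b⟫ = (∑ i, ‖C (i, j)‖ ^ 2) * ⟪a, b⟫ := by
  simp only [inner_mul_mul_left, Finset.sum_mul]

theorem sum_inner_mul_mul_of_orthogonal {C : MatrixSpace k F}
    (hC : ∑ i, star (C (i, 0)) * C (i, 1) = 0) (a b : F) :
    ∑ i, ⟪C (i, 0) * a, C (i, 1) * b⟫ = 0 := by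
  have : ∀ i, ⟪C (i, 0) * a, C (i, 1) * b⟫ = ⟪a * star b, star (C (i, 0)) * C (i, 1)⟫ := by
    intro i
    rw [inner_mul_left_eq, ← mul_assoc, real_inner_comm, inner_mul_right_eq, real_inner_comm]
  rw [Finset.sum_congr rfl fun i _ => this i, ← inner_sum, hC, inner_zero_right]

variable [FiniteDimensional ℝ F]

variable (k) in
/-- Right multiplication by the hermitian matrix with off-diagonal entries `w / √2`, `w⋆ / √2`. -/
def crossOp (w : F) : MatrixSpace k F →L[ℝ] MatrixSpace k F :=
  LinearMap.toContinuousLinearMap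
    { toFun C := WithLp.toLp 2 fun ij =>
        (√2)⁻¹ • if ij.2 = 0 then C (ij.1, 1) * star w else C (ij.1, 0) * w
      map_add' C D := by ext ij; simp only [PiLp.add_apply]; split_ifs <;> simp [add_mul]
      map_smul' r C := by
        ext ij
        simp only [PiLp.smul_apply, RingHom.id_apply]
        split_ifs <;> rw [smul_mul, smul_comm] }

@[simp] theorem crossOp_apply_zero (w : F) (C : MatrixSpace k F) (i : Fin k) :
    crossOp k w C (i, 0) = (√2)⁻¹ • (C (i, 1) * star w) := rfl

@[simp] theorem crossOp_apply_one (w : F) (C : MatrixSpace k F) (i : Fin k) :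
    crossOp k w C (i, 1) = (√2)⁻¹ • (C (i, 0) * w) := rfl

variable {μ : Type*} [Fintype μ]

variable (k) in
/-- Right multiplications by the members of an orthonormal basis of the hermitian `2 × 2`
matrices. -/
def hermitianOp (u : μ → F) : Fin 2 ⊕ μ → MatrixSpace k F →L[ℝ] MatrixSpace k F :=
  Sum.elim (columnOp F k) fun m => crossOp k (u m)

/-- The coordinates of the identity matrix in the basis of `hermitianOp`. -/
def identityCoord (μ : Type*) : Fin 2 ⊕ μ → ℝ := Sum.elim (fun _ => 1) fun _ => 0

/-- The two columns contribute equally, each with factor 1/√2. Letting w run through an orthonormal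
basis of F, these forms together detect whether the columns are orthogonal over F. -/
theorem inner_crossOp (w : F) (C : MatrixSpace k F) :
    ⟪C, crossOp k w C⟫ = √2 * ⟪w, ∑ i, star (C (i, 0)) * C (i, 1)⟫ := by
  have h : √2 * √2 = 2 := Real.mul_self_sqrt (by norm_num)
  have h0 : √2 ≠ 0 := by positivity
  rw [MatrixSpace.inner_eq, inner_sum, Finset.mul_sum]
  refine Finset.sum_congr rfl fun i _ => ?_
  rw [crossOp_apply_zero, crossOp_apply_one, inner_smul_right, inner_smul_right,
    ← inner_mul_right_eq, real_inner_comm (C (i, 0) * w), inner_mul_left_eq]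
  field_simp
  linear_combination (-⟪w, star (C (i, 0)) * C (i, 1)⟫) * h

theorem mem_quadricIntersection_hermitianOp (u : OrthonormalBasis μ ℝ F) (C : MatrixSpace k F) :
    C ∈ quadricIntersection (hermitianOp k u) (identityCoord μ) ↔ HasOrthonormalColumns C := by
  have h0 : √2 ≠ 0 := by positivity
  simp only [quadricIntersection, Set.mem_ofPred_eq, hermitianOp, identityCoord, Sum.forall,
    Sum.elim_inl, Sum.elim_inr, Fin.forall_fin_two, inner_columnOp_zero, inner_columnOp_one,
    inner_crossOp, mul_eq_zero, h0, false_or, HasOrthonormalColumns, and_assoc]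
  refine and_congr_right fun _ => and_congr_right fun _ => ⟨fun h => ?_, fun h m => by simp [h]⟩
  refine (u.sum_repr _).symm.trans (Finset.sum_eq_zero fun m _ => ?_)
  rw [u.repr_apply_apply, h m, zero_smul]

variable (u : OrthonormalBasis μ ℝ F)

theorem hermitianOp_symm (a : Fin 2 ⊕ μ) (C D : MatrixSpace k F) :
    ⟪hermitianOp k u a C, D⟫ = ⟪C, hermitianOp k u a D⟫ := by
  rw [MatrixSpace.inner_eq, MatrixSpace.inner_eq]
  refine Finset.sum_congr rfl fun i _ => ?_
  rcases a with l | m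
  · fin_cases l <;> simp [hermitianOp]
  · simp only [hermitianOp, Sum.elim_inr, crossOp_apply_zero, crossOp_apply_one, inner_smul_left,
      inner_smul_right, inner_mul_right_eq, star_star]
    simp
    ring

theorem hermitianOp_orthonormal {C : MatrixSpace k F} (hC : HasOrthonormalColumns C) :
    Orthonormal ℝ fun a => hermitianOp k u a C := by
  classical
  have h : (√2)⁻¹ * (√2)⁻¹ = 2⁻¹ := by
    rw [← mul_inv, Real.mul_self_sqrt (by norm_num)]
  have h01 : ∀ w : F, ∑ i, ⟪C (i, 0), C (i, 1) * w⟫ = 0 := fun w => by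
    simpa using sum_inner_mul_mul_of_orthogonal hC.2.2 1 w
  have h10 : ∀ w : F, ∑ i, ⟪C (i, 1), C (i, 0) * w⟫ = 0 := fun w => by
    simpa [real_inner_comm] using sum_inner_mul_mul_of_orthogonal hC.2.2 w 1
  have h01' : ∀ w : F, ∑ i, ⟪C (i, 0) * w, C (i, 1)⟫ = 0 := fun w => by
    simpa using sum_inner_mul_mul_of_orthogonal hC.2.2 w 1
  have h10' : ∀ w : F, ∑ i, ⟪C (i, 1) * w, C (i, 0)⟫ = 0 := fun w => by
    simpa [real_inner_comm] using sum_inner_mul_mul_of_orthogonal hC.2.2 1 w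
  rw [orthonormal_iff_ite]
  rintro (l | m) (l' | m')
  · fin_cases l <;> fin_cases l' <;>
      simp only [hermitianOp, Sum.elim_inl, MatrixSpace.inner_eq] <;> simp [hC.1, hC.2.1]
  · fin_cases l <;>
      simp [hermitianOp, MatrixSpace.inner_eq, inner_smul_right, ← Finset.mul_sum, h01, h10]
  · fin_cases l' <;>
      simp [hermitianOp, MatrixSpace.inner_eq, inner_smul_left, ← Finset.mul_sum, h01', h10']
  · have hu := orthonormal_iff_ite.1 u.orthonormal m m'
    simp only [hermitianOp, MatrixSpace.inner_eq, Sum.elim_inr, crossOp_apply_zero,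
      crossOp_apply_one, inner_smul_right, inner_smul_left, Finset.sum_add_distrib,
      ← Finset.mul_sum, sum_inner_mul_mul, hC.1, hC.2.1, inner_star_star, hu, Sum.inr.injEq]
    simp only [conj_trivial, ← mul_assoc, h]
    split_ifs <;> norm_num

/-- The two column projections together contribute ‖X‖². Each cross operator swaps the columns and
multiplies by a unit scalar over √2, hence contributes half of ‖X‖². -/
theorem sum_norm_sq_hermitianOp (X : MatrixSpace k F) :
    ∑ a, ‖hermitianOp k u a X‖ ^ 2 = (1 + (Fintype.card μ : ℝ) / 2) * ‖X‖ ^ 2 := by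
  have h : (√2)⁻¹ ^ 2 = 2⁻¹ := by rw [inv_pow, Real.sq_sqrt (by norm_num)]
  have hcol : ∑ l, ‖columnOp F k l X‖ ^ 2 = ‖X‖ ^ 2 := by
    simp [Fin.sum_univ_two, MatrixSpace.norm_sq_eq, Finset.sum_add_distrib]
  have hcross : ∀ m, ‖crossOp k (u m) X‖ ^ 2 = 2⁻¹ * ‖X‖ ^ 2 := by
    intro m
    simp only [MatrixSpace.norm_sq_eq, crossOp_apply_zero, crossOp_apply_one, norm_smul, norm_mul,
      mul_pow, norm_star_eq, u.orthonormal.1 m, Finset.mul_sum, Real.norm_eq_abs, sq_abs, h]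
    refine Finset.sum_congr rfl fun i _ => ?_
    ring
  rw [Fintype.sum_sum_type]
  simp only [hermitianOp, Sum.elim_inl, Sum.elim_inr, hcol, hcross, Finset.sum_const,
    Finset.card_univ, nsmul_eq_mul]
  ring

/-- Swapping the columns leaves no diagonal blocks. -/
theorem trace_crossOp (w : F) :
    LinearMap.trace ℝ (MatrixSpace k F) (crossOp k w).toLinearMap = 0 := by
  rw [trace_eq_sum_inner_apply (stdOrthonormalBasis ℝ F), Fintype.sum_prod_type]
  simp [Fin.sum_univ_two]

theorem sum_trace_hermitianOp (X : MatrixSpace k F) :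
    ∑ a, LinearMap.trace ℝ (MatrixSpace k F) (hermitianOp k u a).toLinearMap *
      ⟪X, hermitianOp k u a X⟫ = (Fintype.card μ * k : ℝ) * ‖X‖ ^ 2 := by
  rw [Fintype.sum_sum_type]
  simp [hermitianOp, trace_columnOp u, trace_crossOp, Fin.sum_univ_two, inner_columnOp_zero,
    inner_columnOp_one, MatrixSpace.norm_sq_eq, Finset.sum_add_distrib, mul_add]

theorem sum_normal_columnOp {C : MatrixSpace k F} (hC : HasOrthonormalColumns C) (l : Fin 2) :
    ∑ b, ⟪hermitianOp k u b C, columnOp F k l (hermitianOp k u b C)⟫ =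
      1 + (Fintype.card μ : ℝ) / 2 := by
  have h : (√2)⁻¹ ^ 2 = 2⁻¹ := by rw [inv_pow, Real.sq_sqrt (by norm_num)]
  rw [Fintype.sum_sum_type]
  fin_cases l <;>
  simp [hermitianOp, Fin.sum_univ_two, inner_columnOp_zero, inner_columnOp_one, norm_smul, mul_pow,
    hC.1, hC.2.1, norm_star_eq, u.orthonormal.1, ← Finset.mul_sum, div_eq_mul_inv]

/-- Either one column of Q_b C vanishes, or its columns are scalar multiples of the two orthogonal
columns of C in swapped order; in both cases they stay orthogonal. -/
theorem sum_normal_crossOp {C : MatrixSpace k F} (hC : HasOrthonormalColumns C) (w : F)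
    (b : Fin 2 ⊕ μ) : ⟪hermitianOp k u b C, crossOp k w (hermitianOp k u b C)⟫ = 0 := by
  have h10 : ∀ a b : F, ∑ i, ⟪C (i, 1) * a, C (i, 0) * b⟫ = 0 := fun a b => by
    simpa [real_inner_comm] using sum_inner_mul_mul_of_orthogonal hC.2.2 b a
  rcases b with l | m
  · fin_cases l <;> simp [hermitianOp, MatrixSpace.inner_eq]
  · simp [hermitianOp, MatrixSpace.inner_eq, inner_smul_left, inner_smul_right, ← Finset.mul_sum,
      Finset.sum_add_distrib, smul_mul, mul_assoc, h10, sum_inner_mul_mul_of_orthogonal hC.2.2]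

theorem isQuadricSystem_hermitianOp :
    IsQuadricSystem (hermitianOp k u) (identityCoord μ) (1 + (Fintype.card μ : ℝ) / 2)
      (Fintype.card μ * k) where
  symm := hermitianOp_symm u
  orthonormal C hC := hermitianOp_orthonormal u ((mem_quadricIntersection_hermitianOp u C).1 hC)
  sum_norm_sq := sum_norm_sq_hermitianOp u
  sum_trace := sum_trace_hermitianOp u
  sum_normal C hC X := by
    rw [mem_quadricIntersection_hermitianOp] at hC
    rw [Fintype.sum_sum_type]
    have h1 : ∀ l, hermitianOp k u (Sum.inl l) = columnOp F k l := fun l => rfl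
    have h2 : ∀ m, hermitianOp k u (Sum.inr m) = crossOp k (u m) := fun m => rfl
    have h3 := sum_normal_columnOp u hC
    have h4 := sum_normal_crossOp u hC
    simp only [h1, h2, h3, h4]
    simp [Fin.sum_univ_two, inner_columnOp_zero,
      inner_columnOp_one, MatrixSpace.norm_sq_eq, Finset.sum_add_distrib, mul_add]

variable (F k) in
/-- The Stiefel variety of orthonormal `2`-frames in `F ^ k` is a submanifold of the sphere of
radius `√2` with `ACS < 0`, as soon as `k` is large enough. -/
theorem stiefel_isSubmanifold_negativeACS {n d : ℕ} (hd : Module.finrank ℝ F = d) (hn : 0 < n)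
    (hdim : n + (2 + d) = k * 2 * d)
    (hneg : 6 * (1 + (d : ℝ) / 2) + (1 + (d : ℝ) / 2) / 4 < 2 * (d * k)) :
    toMatrixSpace '' stiefel k F ⊆ Metric.sphere 0 (√2) ∧
      IsSubmanifold n (toMatrixSpace '' stiefel k F) ∧
      NegativeACS n (toMatrixSpace '' stiefel k F) := by
  subst hd
  let u := stdOrthonormalBasis ℝ F
  have hM : toMatrixSpace '' stiefel k F =
      quadricIntersection (hermitianOp k u) (identityCoord _) := by
    ext C
    rw [toMatrixSpace_image_stiefel, mem_quadricIntersection_hermitianOp, Set.mem_ofPred_eq]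
  have hdim' : n + Fintype.card (Fin 2 ⊕ Fin (Module.finrank ℝ F)) =
      Module.finrank ℝ (MatrixSpace k F) := by
    rw [(WithLp.linearEquiv 2 ℝ (Fin k × Fin 2 → F)).finrank_eq, Module.finrank_pi_fintype]
    simpa using hdim
  refine ⟨?_, ?_, ?_⟩
  · rw [toMatrixSpace_image_stiefel]
    intro C hC
    rw [mem_sphere_zero_iff_norm, ← norm_sq_of_hasOrthonormalColumns hC,
      Real.sqrt_sq (norm_nonneg _)]
  · rw [hM]
    exact isSubmanifold_quadricIntersection (isQuadricSystem_hermitianOp u) hdim'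
  · rw [hM]
    exact negativeACS_quadricIntersection (isQuadricSystem_hermitianOp u) hn hdim'
      (by simpa using hneg)

end StiefelQuadrics

/-! ### Transitivity on orthonormal 2-frames -/

section Orbit

/-- With w = x - y and D = 1 - y^* x one has w^* w = D + D^*. As Λ is a two-sided inverse of -D, the
quadratic term of (1 + wΛw^*)(1 + wΛ^*w^*) cancels the linear ones. No commutativity is used, so
quaternions are covered. -/
theorem isUnitary_reflection {k : ℕ} {F : Type*} [Ring F] [StarRing F]
    {x y : Matrix (Fin k) Unit F} {Λ : Matrix Unit Unit F} (hx : xᴴ * x = 1) (hy : yᴴ * y = 1)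
    (h1 : Λ * (1 - yᴴ * x) = -1) (h2 : (1 - yᴴ * x) * Λ = -1) :
    1 + (x - y) * Λ * (x - y)ᴴ ∈ unitary (Matrix (Fin k) (Fin k) F) := by
  set D := 1 - yᴴ * x with hD
  have h3 : Λᴴ * Dᴴ = -1 := by rw [← Matrix.conjTranspose_mul, h2]; simp
  have h4 : Dᴴ * Λᴴ = -1 := by rw [← Matrix.conjTranspose_mul, h1]; simp
  have hw : (x - y)ᴴ * (x - y) = D + Dᴴ := by
    simp only [hD, Matrix.conjTranspose_sub, Matrix.conjTranspose_mul,
      Matrix.sub_mul, Matrix.mul_sub, hx, hy, Matrix.conjTranspose_one,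
      Matrix.conjTranspose_conjTranspose]
    abel
  set w := x - y
  have e1 : Λᴴ * (wᴴ * w) * Λ = -Λᴴ - Λ := by
    rw [hw, mul_add, add_mul, h3, mul_assoc, h2]
    simp [sub_eq_add_neg]
  have e2 : Λ * (wᴴ * w) * Λᴴ = -Λᴴ - Λ := by
    rw [hw, mul_add, add_mul, h1, mul_assoc, h4]
    simp [sub_eq_add_neg]
  have hs : star (1 + w * Λ * wᴴ) = 1 + w * Λᴴ * wᴴ := by
    simp [Matrix.star_eq_conjTranspose, Matrix.conjTranspose_mul, Matrix.mul_assoc]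
  have key : ∀ S T : Matrix Unit Unit F, S * (wᴴ * w) * T = -Λᴴ - Λ → S + T = Λ + Λᴴ →
      (1 + w * S * wᴴ) * (1 + w * T * wᴴ) = 1 := by
    intro S T h h'
    have h5 : (w * S * wᴴ) * (w * T * wᴴ) = w * (S * (wᴴ * w) * T) * wᴴ := by
      simp only [Matrix.mul_assoc]
    have h6 : w * S * wᴴ + w * T * wᴴ = w * (Λ + Λᴴ) * wᴴ := by
      rw [← h', Matrix.mul_add, Matrix.add_mul]
    rw [mul_add, add_mul, add_mul, h5, h, one_mul, one_mul, mul_one, add_assoc, ← add_assoc _ _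
      (w * (-Λᴴ - Λ) * wᴴ), h6, ← Matrix.add_mul, ← Matrix.mul_add, show Λ + Λᴴ + (-Λᴴ - Λ) = 0 by abel]
    simp
  rw [Unitary.mem_iff, hs]
  exact ⟨key _ _ e1 (add_comm _ _), key _ _ e2 rfl⟩

variable {F : Type*} [NormedDivisionRing F] [InnerProductSpace ℝ F] [StarRing F]
  [IsEuclideanStarRing F] {k : ℕ}

theorem eq_zero_of_conjTranspose_mul_self {w : Matrix (Fin k) Unit F} (h : wᴴ * w = 0) :
    w = 0 := by
  have h1 := congrFun (congrFun h ()) ()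
  simp only [Matrix.mul_apply, Matrix.conjTranspose_apply, IsEuclideanStarRing.star_mul_self_eq,
    ← Finset.sum_smul, Matrix.zero_apply, smul_eq_zero, one_ne_zero, or_false] at h1
  rw [Finset.sum_eq_zero_iff_of_nonneg fun _ _ => by positivity] at h1
  ext i j
  simpa using h1 i (Finset.mem_univ i)

/-- A unitary reflection taking the unit vector `x` to the unit vector `y` and fixing the vectors
orthogonal to both. -/
theorem exists_unitary_mul_eq {x y : Matrix (Fin k) Unit F} (hx : xᴴ * x = 1) (hy : yᴴ * y = 1) :
    ∃ A ∈ unitary (Matrix (Fin k) (Fin k) F), A * x = y ∧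
      ∀ z : Matrix (Fin k) Unit F, xᴴ * z = 0 → yᴴ * z = 0 → A * z = z := by
  by_cases hxy : x = y
  · exact ⟨1, one_mem _, by simp [hxy], fun z _ _ => by simp⟩
  set D := 1 - yᴴ * x with hD
  -- If y^* x = 1 for unit vectors, then (x - y)^* (x - y) = 0 and x = y.
  have hd : D () () ≠ 0 := by
    intro h0
    have hD0 : D = 0 := by ext i j; exact h0
    refine hxy (sub_eq_zero.1 (eq_zero_of_conjTranspose_mul_self ?_))
    have hyx : yᴴ * x = 1 := (sub_eq_zero.1 hD0).symm
    have hxy' : xᴴ * y = 1 := by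
      have := congrArg Matrix.conjTranspose hyx
      simpa [Matrix.conjTranspose_mul] using this
    simp [Matrix.conjTranspose_sub, Matrix.sub_mul, Matrix.mul_sub, hx, hy, hyx, hxy']
  let Λ : Matrix Unit Unit F := Matrix.of fun _ _ => -(D () ())⁻¹
  have h1 : Λ * D = -1 := by ext; simp [Λ, Matrix.mul_apply, hd]
  have h2 : D * Λ = -1 := by ext; simp [Λ, Matrix.mul_apply, hd]
  refine ⟨_, isUnitary_reflection hx hy h1 h2, ?_, fun z hxz hyz => ?_⟩
  · have : (x - y)ᴴ * x = D := by
      rw [Matrix.conjTranspose_sub, Matrix.sub_mul, hx]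
    rw [Matrix.add_mul, Matrix.one_mul, Matrix.mul_assoc, this, Matrix.mul_assoc, h1]
    simp
  · have : (x - y)ᴴ * z = 0 := by
      rw [Matrix.conjTranspose_sub, Matrix.sub_mul, hxz, hyz, sub_zero]
    rw [Matrix.add_mul, Matrix.mul_assoc _ _ z, this]
    simp

theorem conjTranspose_mul_baseFrame {F : Type*} [Ring F] [StarRing F] (hk : 2 ≤ k) :
    (baseFrame k F)ᴴ * baseFrame k F = 1 := by
  ext i j
  rw [Matrix.mul_apply, Finset.sum_eq_single (⟨i, by omega⟩ : Fin k)]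
  · simp [baseFrame, Matrix.one_apply, Fin.ext_iff]
  · intro b _ hb
    have : (b : ℕ) ≠ i := fun h => hb (Fin.ext h)
    simp [baseFrame, this]
  · simp

theorem orbit_subset_stiefel {F : Type*} [Ring F] [StarRing F] (G : Subgroup (UnitaryPairs k F))
    {C : Matrix (Fin k) (Fin 2) F} (hC : C ∈ stiefel k F) : orbit G C ⊆ stiefel k F := by
  rintro _ ⟨⟨A, B⟩, -, rfl⟩
  have hA : (A : Matrix (Fin k) (Fin k) F)ᴴ * A = 1 := Unitary.coe_star_mul_self A
  have hB : ((B⁻¹ : unitary (Matrix (Fin 2) (Fin 2) F)) : Matrix (Fin 2) (Fin 2) F)ᴴ *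
      (B⁻¹ : unitary (Matrix (Fin 2) (Fin 2) F)) = 1 := Unitary.coe_star_mul_self B⁻¹
  have hC' : Cᴴ * C = 1 := hC
  show _ = _
  simp only [Matrix.conjTranspose_mul, Matrix.mul_assoc]
  rw [← Matrix.mul_assoc _ (A : Matrix (Fin k) (Fin k) F), hA, Matrix.one_mul,
    ← Matrix.mul_assoc _ C, hC', Matrix.one_mul, hB]

theorem exists_unitary_mul_baseFrame (hk : 2 ≤ k) {C : Matrix (Fin k) (Fin 2) F}
    (hC : C ∈ stiefel k F) :
    ∃ A ∈ unitary (Matrix (Fin k) (Fin k) F), A * baseFrame k F = C := by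
  let col : Matrix (Fin k) (Fin 2) F → Fin 2 → Matrix (Fin k) Unit F :=
    fun M j => Matrix.of fun i _ => M i j
  have hcol : ∀ M : Matrix (Fin k) (Fin 2) F, Mᴴ * M = 1 → ∀ i j, (col M i)ᴴ * col M j =
      if i = j then 1 else 0 := by
    intro M hM i j
    ext a b
    have := congrFun (congrFun hM i) j
    simp only [Matrix.mul_apply, Matrix.conjTranspose_apply, Matrix.one_apply] at this
    simp only [Matrix.mul_apply, Matrix.conjTranspose_apply, col, Matrix.of_apply, this]
    split_ifs <;> simp
  have he := hcol _ (conjTranspose_mul_baseFrame (F := F) hk)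
  have hc := hcol C hC
  obtain ⟨A, hA, hAx, -⟩ := exists_unitary_mul_eq (x := col (baseFrame k F) 0) (y := col C 0)
    (by simpa using he 0 0) (by simpa using hc 0 0)
  have hA1 : Aᴴ * A = 1 := (Unitary.mem_iff.1 hA).1
  have hA2 : A * Aᴴ = 1 := (Unitary.mem_iff.1 hA).2
  have hq : (Aᴴ * col C 1)ᴴ * col (baseFrame k F) 0 = 0 := by
    rw [Matrix.conjTranspose_mul, Matrix.conjTranspose_conjTranspose, Matrix.mul_assoc, hAx]
    simpa using hc 1 0
  -- A already sends the first base vector to the first column of C. B is aimed at the second column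
  -- pulled back by A^*, which by `hq` is orthogonal to the first base vector, so B fixes that
  -- vector and A * B is correct on both.
  obtain ⟨B, hB, hBx, hBz⟩ := exists_unitary_mul_eq (x := col (baseFrame k F) 1)
    (y := Aᴴ * col C 1) (by simpa using he 1 1) (by
      rw [Matrix.conjTranspose_mul, Matrix.conjTranspose_conjTranspose, Matrix.mul_assoc,
        ← Matrix.mul_assoc A, hA2, Matrix.one_mul]
      simpa using hc 1 1)
  have hB0 := hBz (col (baseFrame k F) 0) (by simpa using he 1 0) hq
  have h0 : A * B * col (baseFrame k F) 0 = col C 0 := by rw [Matrix.mul_assoc, hB0, hAx]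
  have h1 : A * B * col (baseFrame k F) 1 = col C 1 := by
    rw [Matrix.mul_assoc, hBx, ← Matrix.mul_assoc, hA2, Matrix.one_mul]
  refine ⟨A * B, mul_mem hA hB, ?_⟩
  ext i j
  fin_cases j
  · exact congrFun (congrFun h0 i) ()
  · exact congrFun (congrFun h1 i) ()

/-- A diagonal unitary matrix that differs from the identity only in the third entry fixes the base
frame, so it can absorb the determinant; this needs k ≥ 3. -/
theorem exists_unitary_det_eq_one_mul_baseFrame {F : Type*} [NormedField F]
    [InnerProductSpace ℝ F] [StarRing F] [IsEuclideanStarRing F] (hk : 3 ≤ k)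
    {C : Matrix (Fin k) (Fin 2) F} (hC : C ∈ stiefel k F) :
    ∃ A ∈ unitary (Matrix (Fin k) (Fin k) F), A.det = 1 ∧ A * baseFrame k F = C := by
  obtain ⟨A, hA, hAC⟩ := exists_unitary_mul_baseFrame (by omega) hC
  have hdet : A.det * star A.det = 1 := by
    have := congrArg Matrix.det (Unitary.mem_iff.1 hA).2
    rwa [Matrix.star_eq_conjTranspose, Matrix.det_mul, Matrix.det_conjTranspose,
      Matrix.det_one] at this
  let i₀ : Fin k := ⟨2, by omega⟩
  let v : Fin k → F := fun i => if i = i₀ then star A.det else 1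
  have hv : ∀ i, star (v i) * v i = 1 := by
    intro i
    by_cases hi : i = i₀ <;> simp [v, hi, hdet]
  have hD : Matrix.diagonal v ∈ unitary (Matrix (Fin k) (Fin k) F) := by
    rw [Unitary.mem_iff, Matrix.star_eq_conjTranspose, Matrix.diagonal_conjTranspose,
      Matrix.diagonal_mul_diagonal, Matrix.diagonal_mul_diagonal, ← Matrix.diagonal_one]
    refine ⟨congrArg _ (funext hv), congrArg _ (funext fun i => ?_)⟩
    rw [mul_comm]
    exact hv i
  refine ⟨A * Matrix.diagonal v, mul_mem hA hD, ?_, ?_⟩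
  · rw [Matrix.det_mul, Matrix.det_diagonal]
    simpa [v] using hdet
  · rw [Matrix.mul_assoc, show Matrix.diagonal v * baseFrame k F = baseFrame k F from ?_, hAC]
    ext i j
    rw [Matrix.diagonal_mul]
    by_cases hi : i = i₀
    · have : (2 : ℕ) ≠ j := by omega
      simp [baseFrame, hi, i₀, this]
    · simp [v, hi]

theorem orbit_realGroup (hk : 3 ≤ k) : orbit (realGroup k) (baseFrame k ℝ) = stiefel k ℝ := by
  refine (orbit_subset_stiefel _ (conjTranspose_mul_baseFrame (by omega))).antisymm fun C hC => ?_
  obtain ⟨A, hA, hdet, hAC⟩ := exists_unitary_det_eq_one_mul_baseFrame hk hC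
  exact ⟨(⟨A, hA⟩, 1), ⟨hdet, by simp⟩, by simp [hAC]⟩

theorem orbit_complexGroup (hk : 3 ≤ k) :
    orbit (complexGroup k) (baseFrame k ℂ) = stiefel k ℂ := by
  refine (orbit_subset_stiefel _ (conjTranspose_mul_baseFrame (by omega))).antisymm fun C hC => ?_
  obtain ⟨A, hA, hdet, hAC⟩ := exists_unitary_det_eq_one_mul_baseFrame hk hC
  refine ⟨(⟨A, hA⟩, 1), ?_, by simp [hAC]⟩
  show A.det * _ = 1
  simp [hdet]

theorem orbit_quaternionicGroup (hk : 2 ≤ k) :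
    orbit (quaternionicGroup k) (baseFrame k ℍ[ℝ]) = stiefel k ℍ[ℝ] := by
  refine (orbit_subset_stiefel _ (conjTranspose_mul_baseFrame hk)).antisymm fun C hC => ?_
  obtain ⟨A, hA, hAC⟩ := exists_unitary_mul_baseFrame hk hC
  exact ⟨(⟨A, hA⟩, 1), Subgroup.mem_top _, by simp [hAC]⟩

end Orbit

end ACS

end

theorem mainTheorem9 :
    (∀ k : ℕ, 6 ≤ k →
      ACS.orbit (ACS.realGroup k) (ACS.baseFrame k ℝ) = ACS.stiefel k ℝ ∧
      ACS.toMatrixSpace '' ACS.stiefel k ℝ ⊆ Metric.sphere 0 (√2) ∧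
      ACS.IsSubmanifold (2 * k - 3) (ACS.toMatrixSpace '' ACS.stiefel k ℝ) ∧
      ACS.NegativeACS (2 * k - 3) (ACS.toMatrixSpace '' ACS.stiefel k ℝ)) ∧
    (∀ k : ℕ, 4 ≤ k →
      ACS.orbit (ACS.complexGroup k) (ACS.baseFrame k ℂ) = ACS.stiefel k ℂ ∧
      ACS.toMatrixSpace '' ACS.stiefel k ℂ ⊆ Metric.sphere 0 (√2) ∧
      ACS.IsSubmanifold (4 * k - 4) (ACS.toMatrixSpace '' ACS.stiefel k ℂ) ∧
      ACS.NegativeACS (4 * k - 4) (ACS.toMatrixSpace '' ACS.stiefel k ℂ)) ∧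
    (∀ k : ℕ, 3 ≤ k →
      ACS.orbit (ACS.quaternionicGroup k) (ACS.baseFrame k ℍ[ℝ]) = ACS.stiefel k ℍ[ℝ] ∧
      ACS.toMatrixSpace '' ACS.stiefel k ℍ[ℝ] ⊆ Metric.sphere 0 (√2) ∧
      ACS.IsSubmanifold (8 * k - 6) (ACS.toMatrixSpace '' ACS.stiefel k ℍ[ℝ]) ∧
      ACS.NegativeACS (8 * k - 6) (ACS.toMatrixSpace '' ACS.stiefel k ℍ[ℝ])) := by
  refine ⟨fun k hk => ⟨ACS.orbit_realGroup (by omega), ?_⟩,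
    fun k hk => ⟨ACS.orbit_complexGroup (by omega), ?_⟩,
    fun k hk => ⟨ACS.orbit_quaternionicGroup (by omega), ?_⟩⟩ <;>
    have hk' := (Nat.cast_le (α := ℝ)).2 hk <;> push_cast at hk'
  -- For d = 1, 2, 4 one has κ = 3/2, 2, 3, and the numerical condition reads 75/8 < 2k, 25/2 < 4k,
  -- 75/4 < 8k.
  · exact ACS.stiefel_isSubmanifold_negativeACS ℝ k (Module.finrank_self ℝ) (by omega) (by omega)
      (by push_cast; linarith)
  · exact ACS.stiefel_isSubmanifold_negativeACS ℂ k Complex.finrank_real_complex (by omega)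
      (by omega) (by push_cast; linarith)
  · exact ACS.stiefel_isSubmanifold_negativeACS ℍ[ℝ] k Quaternion.finrank_eq_four (by omega)
      (by omega) (by push_cast; linarith)
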